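/- Let $\mathbb{R}^{1,3}$ be Minkowski space with coordinates $(T,X,Y,Z)$ and form $\langle\cdot,\cdot\rangle = dT^2-dX^2-dY^2-dZ^2$, identified with Hermitian $2\times 2$ matrices by $(T,X,Y,Z)\leftrightarrow \frac12\begin{pmatrix}T+Z & X+iY\\ X-iY& T-Z\end{pmatrix}$; let $\mathbb{H}^3=\{\langle x,x\rangle=1,\ T>0\}$ and let $A\in SL(2,\mathbb{C})$ act by $S\mapsto ASA^*$. For a nonzero spinor $\kappa=(\xi,\eta)\in\mathbb{C}^2$ put $\phi_1(\kappa)=\kappa\kappa^*$ and let $v_\kappa = D_\kappa\phi_1(i\bar\eta,-i\bar\xi)$. The decorated horosphere of $\kappa$ is $H=\{x\in\mathbb{H}^3 : \langle x,\phi_1(\kappa)\rangle=1\}$ with the parallel unit tangent field $v$ whose direction at $q\in H$ is the intersection of $T_qH$ with the half-plane $\{a\,\phi_1(\kappa)+b\,v_\kappa : a\in\mathbb{R},\ b>0\}$. With $N^{out}$ the unit normal of $H$ pointing towards its centre and $N^{in}=-N^{out}$, a spin decoration of $(H,v)$ is a pair $W=(W^{in},W^{out})$ of continuous lifts of the right-handed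 frame fields $(N^{in},v,N^{in}\times v)$ and $(N^{out},v,N^{out}\times v)$ to the spin double cover (isomorphic to $SL(2,\mathbb{C})$) of the orthonormal frame bundle of $\mathbb{H}^3$, such that $W^{in}$ is obtained from $W^{out}$ by rotation by $\pi$ about $v$, equivalently $W^{out}$ from $W^{in}$ by rotation by $-\pi$. There is a continuous lift $\kappa\mapsto(H_\kappa,W_\kappa)$ of this map from nonzero spinors to decorated horospheres, with values in spin-decorated horospheres. Let such a lift be given (any one), let $\kappa_1=(\xi_1,\eta_1)$, $\kappa_2=(\xi_2,\eta_2)$ be nonzero spinors, $(H_i,W_i)$ the corresponding spin-decorated horospheres, and $\{\kappa_1,\kappa_2\}=\xi_1\eta_2-\eta_1\xi_2$. If $H_1,H_2$ have distinct centres $z_1,z_2$, let $\gamma$ be the oriented geodesic from $z_1$ to $z_2$ and $q_i=\gamma\cap H_i$. The complex distance from $(H_1,W_1)$ to $(H_2,W_2)$ is $d=\rho+i\theta$, where translation along $\gamma$ by the signed distance $\rho$ followed by rotation about $\gamma$ by the angle $\theta$ takes the spin frame $W_1^{in}(q_1)$ to the spin frame $W_2^{out}(q_2)$. Such $d$ exists,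 is well defined exactly modulo $4\pi i$, and $$\{\kappa_1,\kappa_2\}=\exp\left(\frac d2\right).$$ In all cases $\{\kappa_1,\kappa_2\}$ equals the complex lambda length $\lambda_{12}$ from $(H_1,W_1)$ to $(H_2,W_2)$, where $\lambda_{12}=\exp(d/2)$ if the centres are distinct and $\lambda_{12}=0$ if the centres coincide. -/

import Mathlib

open scoped Matrix

namespace HoroSpin

noncomputable section

/-! ## Spinors, Minkowski space, and the action of `SL(2,ℂ)` -/

/-- Nonzero spinors `κ = (ξ, η)`: nonzero vectors of `ℂ²`. -/
abbrev Spinor : Type := {κ : Fin 2 → ℂ // κ ≠ 0}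

/-- The complex symplectic form `{κ, κ'} = ξ η' - η ξ'` on `ℂ²`. -/
def sympl (κ κ' : Fin 2 → ℂ) : ℂ := κ 0 * κ' 1 - κ 1 * κ' 0

/-- Minkowski space `ℝ^{1,3}` with coordinates `(T, X, Y, Z)`. -/
abbrev Mink : Type := Fin 4 → ℝ

/-- The Lorentzian form of signature `(+,-,-,-)`. -/
def form (x y : Mink) : ℝ := x 0 * y 0 - x 1 * y 1 - x 2 * y 2 - x 3 * y 3

/-- The Hermitian matrix `½ [[T+Z, X+iY], [X-iY, T-Z]]` of a point of Minkowski space. -/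
def toHerm (x : Mink) : Matrix (Fin 2) (Fin 2) ℂ :=
  (1 / 2 : ℂ) • !![(x 0 : ℂ) + x 3, (x 1 : ℂ) + Complex.I * x 2;
                   (x 1 : ℂ) - Complex.I * x 2, (x 0 : ℂ) - x 3]

/-- The point of Minkowski space of a Hermitian matrix (the inverse of `toHerm`). -/
def ofHerm (S : Matrix (Fin 2) (Fin 2) ℂ) : Mink :=
  ![(S 0 0 + S 1 1).re, 2 * (S 0 1).re, 2 * (S 0 1).im, (S 0 0 - S 1 1).re]

/-- `SL(2,ℂ)`, with its usual topology. -/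
abbrev SL2C : Type := Matrix.SpecialLinearGroup (Fin 2) ℂ

/-- The action of `A ∈ SL(2,ℂ)` on Minkowski space, `A.S = A S A*` on Hermitian matrices. -/
def act (A : SL2C) (x : Mink) : Mink := ofHerm (A.1 * toHerm x * A.1ᴴ)

/-- The hyperboloid model of hyperbolic 3-space. -/
def hyp3 : Set Mink := {x | form x x = 1 ∧ 0 < x 0}

/-- The future light cone. -/
def lightCone : Set Mink := {x | form x x = 0 ∧ 0 < x 0}

/-! ## Pointed oriented null flags, and the flag of a spinor -/

/-- A pointed oriented null flag: a point `p` of the future light cone and a 2-plane `V ∋ p` tangent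
to the light cone, `ℝp ⊂ V ⊂ p^⊥`, with an orientation of `V / ℝp`, given as the open half-plane of
`V` on one side of `ℝp`. -/
structure Flag where
  p : Mink
  p_mem : p ∈ lightCone
  plane : Submodule ℝ Mink
  halfPlane : Set Mink
  exists_gen : ∃ v : Mink, form v p = 0 ∧ LinearIndependent ℝ ![p, v] ∧
    plane = Submodule.span ℝ {p, v} ∧
    halfPlane = {x | ∃ a b : ℝ, 0 < b ∧ x = a • p + b • v}

/-- The flag `[[p, v]]`. -/
def Flag.of (p v : Mink) (hp : p ∈ lightCone) (hv : form v p = 0)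
    (hli : LinearIndependent ℝ ![p, v]) : Flag where
  p := p
  p_mem := hp
  plane := Submodule.span ℝ {p, v}
  halfPlane := {x | ∃ a b : ℝ, 0 < b ∧ x = a • p + b • v}
  exists_gen := ⟨v, hv, hli, rfl, rfl⟩

/-- `φ₁(κ) = κ κ*`. -/
def phi1 (κ : Fin 2 → ℂ) : Mink := ofHerm (Matrix.vecMulVec κ (star κ))

/-- `Z(ξ, η) = (i η̄, -i ξ̄)`. -/
def Zmap (κ : Fin 2 → ℂ) : Fin 2 → ℂ :=
  ![Complex.I * star (κ 1), -(Complex.I * star (κ 0))]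

/-- The (real) derivative of `φ₁` at `κ` in the direction `Z κ`. -/
def dphi1 (κ : Fin 2 → ℂ) : Mink := lineDeriv ℝ phi1 κ (Zmap κ)

theorem phi1_eq (κ : Fin 2 → ℂ) : phi1 κ =
    ![(κ 0).re ^ 2 + (κ 0).im ^ 2 + (κ 1).re ^ 2 + (κ 1).im ^ 2,
      2 * ((κ 0).re * (κ 1).re + (κ 0).im * (κ 1).im),
      2 * ((κ 0).im * (κ 1).re - (κ 0).re * (κ 1).im),
      (κ 0).re ^ 2 + (κ 0).im ^ 2 - (κ 1).re ^ 2 - (κ 1).im ^ 2] := by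
  ext i
  fin_cases i <;> simp [phi1, ofHerm, Matrix.vecMulVec_apply] <;> ring

theorem dphi1_eq (κ : Fin 2 → ℂ) : dphi1 κ =
    ![0,
      4 * ((κ 1).re * (κ 1).im - (κ 0).re * (κ 0).im),
      2 * ((κ 0).re ^ 2 - (κ 0).im ^ 2 + (κ 1).re ^ 2 - (κ 1).im ^ 2),
      4 * ((κ 0).re * (κ 1).im + (κ 0).im * (κ 1).re)] := by
  have key : ∀ c v : Mink, (∃ w : Mink, (fun t : ℝ => phi1 (κ + t • Zmap κ)) =
      fun t : ℝ => c + t • v + (t ^ 2) • w) → dphi1 κ = v := by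
    rintro c v ⟨w, h⟩
    unfold dphi1 lineDeriv
    rw [h]
    have h1 : HasDerivAt (fun t : ℝ => c + t • v + (t ^ 2) • w)
        ((1 : ℝ) • v + ((2 : ℕ) * (0 : ℝ) ^ (2 - 1)) • w) 0 :=
      (((hasDerivAt_id (0 : ℝ)).smul_const v).const_add c).add
        ((hasDerivAt_pow 2 (0 : ℝ)).smul_const w)
    rw [h1.deriv]
    simp
  refine key (phi1 κ) _ ⟨phi1 (Zmap κ), ?_⟩
  funext t
  ext i
  rw [phi1_eq, phi1_eq, phi1_eq]
  fin_cases i <;> simp [Zmap] <;> ring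

theorem normSq_pos (κ : Spinor) :
    0 < (κ.1 0).re ^ 2 + (κ.1 0).im ^ 2 + (κ.1 1).re ^ 2 + (κ.1 1).im ^ 2 := by
  have a0 := sq_nonneg (κ.1 0).re
  have a1 := sq_nonneg (κ.1 0).im
  have a2 := sq_nonneg (κ.1 1).re
  have a3 := sq_nonneg (κ.1 1).im
  by_contra h
  have h0 : (κ.1 0).re = 0 := pow_eq_zero_iff two_ne_zero |>.mp (by linarith)
  have h1 : (κ.1 0).im = 0 := pow_eq_zero_iff two_ne_zero |>.mp (by linarith)
  have h2 : (κ.1 1).re = 0 := pow_eq_zero_iff two_ne_zero |>.mp (by linarith)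
  have h3 : (κ.1 1).im = 0 := pow_eq_zero_iff two_ne_zero |>.mp (by linarith)
  apply κ.2
  ext i
  fin_cases i <;> apply Complex.ext <;> simp [h0, h1, h2, h3]

theorem phi1_mem (κ : Spinor) : phi1 κ.1 ∈ lightCone := by
  have h := normSq_pos κ
  rw [phi1_eq]
  refine ⟨?_, ?_⟩
  · simp [form]; ring
  · simpa using h

theorem form_dphi1 (κ : Spinor) : form (dphi1 κ.1) (phi1 κ.1) = 0 := by
  rw [phi1_eq, dphi1_eq]
  simp [form]; ring

theorem linearIndependent_flag (κ : Spinor) :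
    LinearIndependent ℝ ![phi1 κ.1, dphi1 κ.1] := by
  have h := normSq_pos κ
  rw [LinearIndependent.pair_iff]
  intro s t hst
  rw [phi1_eq, dphi1_eq] at hst
  have e0 := congrFun hst 0
  have e1 := congrFun hst 1
  have e2 := congrFun hst 2
  have e3 := congrFun hst 3
  simp only [Pi.add_apply, Pi.smul_apply, smul_eq_mul, Pi.zero_apply, Matrix.cons_val] at e0 e1 e2 e3
  have hs : s = 0 := by
    have : s * ((κ.1 0).re ^ 2 + (κ.1 0).im ^ 2 + (κ.1 1).re ^ 2 + (κ.1 1).im ^ 2) = 0 := by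
      linarith
    exact (mul_eq_zero.mp this).resolve_right h.ne'
  subst hs
  refine ⟨rfl, ?_⟩
  have : t * ((κ.1 0).re ^ 2 + (κ.1 0).im ^ 2 + (κ.1 1).re ^ 2 + (κ.1 1).im ^ 2) ^ 2 = 0 := by
    linear_combination ((κ.1 1).re * (κ.1 1).im - (κ.1 0).re * (κ.1 0).im) * e1 +
      (1 / 2) * ((κ.1 0).re ^ 2 - (κ.1 0).im ^ 2 + (κ.1 1).re ^ 2 - (κ.1 1).im ^ 2) * e2 +
      (((κ.1 0).re * (κ.1 1).im + (κ.1 0).im * (κ.1 1).re)) * e3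
  exact (mul_eq_zero.mp this).resolve_right (pow_ne_zero 2 h.ne')

/-- The flag `Φ₁(κ) = [[φ₁(κ), D_κ φ₁(Z κ)]]` of a nonzero spinor. -/
def Phi1 (κ : Spinor) : Flag :=
  Flag.of (phi1 κ.1) (dphi1 κ.1) (phi1_mem κ) (form_dphi1 κ) (linearIndependent_flag κ)

/-! ## Horospheres and decorations -/

/-- A horosphere, given by the point `p` of the future light cone such that it is
`{x ∈ ℍ³ | ⟨x, p⟩ = 1}`. -/
structure Horosphere where
  p : Mink
  p_mem : p ∈ lightCone

/-- The points of a horosphere. -/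
def Horosphere.carrier (H : Horosphere) : Set Mink := {x | x ∈ hyp3 ∧ form x H.p = 1}

/-- The centre of a horosphere in `∂ℍ³`, as a point of the celestial sphere: the point with `T = 1`
on the ray of `p`. -/
def Horosphere.centre (H : Horosphere) : Mink := (H.p 0)⁻¹ • H.p

/-- The outward unit normal at `q ∈ H`, that is, the one pointing to the centre: the component of
`p` tangent to `ℍ³` at `q`. -/
def Horosphere.Nout (H : Horosphere) (q : Mink) : Mink := H.p - q

/-- The inward unit normal at `q ∈ H`. -/
def Horosphere.Nin (H : Horosphere) (q : Mink) : Mink := q - H.p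

/-- A decorated horosphere: a horosphere with a parallel unit tangent vector field. Parallel means
invariant under every parabolic isometry that fixes the horosphere (equivalently, its `p`). -/
structure HorD where
  H : Horosphere
  v : H.carrier → Mink
  tangent : ∀ q : H.carrier, form (v q) q = 0 ∧ form (v q) H.p = 0
  unit : ∀ q : H.carrier, form (v q) (v q) = -1
  parallel : ∀ A : SL2C, A.1.IsParabolic → act A H.p = H.p →
    ∀ q q' : H.carrier, (q' : Mink) = act A q → v q' = act A (v q)

/-- `D = Φ₂(F)`: the horosphere of `D` is the one given by the point `p` of the flag `F`, and at each
of its points `q` the oriented line directed by the decoration is the intersection of `T_q H` with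
the oriented flag plane. -/
def IsPhi2 (F : Flag) (D : HorD) : Prop :=
  D.H.p = F.p ∧ ∀ q : D.H.carrier,
    {x : Mink | ∃ b : ℝ, 0 < b ∧ x = b • D.v q} =
      {x | x ∈ F.halfPlane ∧ form x q = 0 ∧ form x D.H.p = 0}

/-! ## Frames and spin frames -/

/-- The cross product of `v, w ∈ T_q ℍ³`, for the orientation in which `(∂X, ∂Y, ∂Z)` is right-handed
at `(1,0,0,0)`: the vector `u` with `⟨u, x⟩ = -det(q, v, w, x)` for all `x`. -/
def cross (q v w : Mink) : Mink :=
  ![-Matrix.det (Matrix.of ![q, v, w, Pi.single 0 1]),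
    Matrix.det (Matrix.of ![q, v, w, Pi.single 1 1]),
    Matrix.det (Matrix.of ![q, v, w, Pi.single 2 1]),
    Matrix.det (Matrix.of ![q, v, w, Pi.single 3 1])]

/-- Four vectors of Minkowski space: a base point `q` and three vectors `f₁, f₂, f₃` there. -/
@[ext]
structure Frame where
  q : Mink
  f₁ : Mink
  f₂ : Mink
  f₃ : Mink

/-- The data form a right-handed orthonormal frame at a point of `ℍ³`. -/
def Frame.IsFrame (F : Frame) : Prop :=
  F.q ∈ hyp3 ∧ form F.f₁ F.q = 0 ∧ form F.f₂ F.q = 0 ∧ form F.f₃ F.q = 0 ∧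
    form F.f₁ F.f₁ = -1 ∧ form F.f₂ F.f₂ = -1 ∧ form F.f₃ F.f₃ = -1 ∧
    form F.f₁ F.f₂ = 0 ∧ form F.f₁ F.f₃ = 0 ∧ form F.f₂ F.f₃ = 0 ∧
    cross F.q F.f₁ F.f₂ = F.f₃

/-- Rotation of a frame by the angle `θ` about its first vector (right-hand rule). -/
def Frame.rotate₁ (θ : ℝ) (F : Frame) : Frame where
  q := F.q
  f₁ := F.f₁
  f₂ := Real.cos θ • F.f₂ + Real.sin θ • F.f₃
  f₃ := Real.cos θ • F.f₃ - Real.sin θ • F.f₂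

/-- Rotation of a frame by the angle `θ` about its second vector (right-hand rule). -/
def Frame.rotate₂ (θ : ℝ) (F : Frame) : Frame where
  q := F.q
  f₁ := Real.cos θ • F.f₁ - Real.sin θ • F.f₃
  f₂ := F.f₂
  f₃ := Real.cos θ • F.f₃ + Real.sin θ • F.f₁

/-- Translation of a frame by the signed distance `ρ` along the geodesic directed by its first
vector (by parallel transport). -/
def Frame.translate (ρ : ℝ) (F : Frame) : Frame where
  q := Real.cosh ρ • F.q + Real.sinh ρ • F.f₁
  f₁ := Real.sinh ρ • F.q + Real.cosh ρ • F.f₁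
  f₂ := F.f₂
  f₃ := F.f₃

/-- The base frame `(∂Z, ∂Y, -∂X)` at `(1,0,0,0)`. -/
def baseFrame : Frame := ⟨![1, 0, 0, 0], ![0, 0, 0, 1], ![0, 0, 1, 0], ![0, -1, 0, 0]⟩

theorem baseFrame_isFrame : baseFrame.IsFrame := by
  have hc : cross ![1, 0, 0, 0] ![0, 0, 0, 1] ![0, 0, 1, 0] = ![0, -1, 0, 0] := by
    ext i
    fin_cases i <;>
      simp [cross, Matrix.det_succ_row_zero, Fin.sum_univ_succ, Fin.succAbove]
  refine ⟨⟨by simp [baseFrame, form], by simp [baseFrame]⟩, ?_, ?_, ?_, ?_, ?_, ?_, ?_, ?_, ?_, hc⟩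
    <;> simp [baseFrame, form]

/-- Spin frames. `PSL(2,ℂ)` acts simply transitively on the right-handed orthonormal frames, so that
`± A ↦ (± A).baseFrame` identifies it with the frame bundle; its universal (double) cover is
`SL(2,ℂ)`, covering the frame bundle by `A ↦ A.baseFrame`. -/
abbrev SpinFrame : Type := SL2C

/-- The covering map from spin frames to frames. -/
def SpinFrame.toFrame (W : SpinFrame) : Frame :=
  ⟨act W baseFrame.q, act W baseFrame.f₁, act W baseFrame.f₂, act W baseFrame.f₃⟩

/-- `W'` is the result of rotating the spin frame `W` by the angle `θ ∈ ℝ` about its first vector: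
the path of rotated frames lifts to a path of spin frames from `W` (at angle `0`) to `W'` (at angle
`θ`). -/
def SpinFrame.Rotate₁ (θ : ℝ) (W W' : SpinFrame) : Prop :=
  ∃ w : ℝ → SpinFrame, Continuous w ∧ w 0 = W ∧ w θ = W' ∧
    ∀ t, (w t).toFrame = W.toFrame.rotate₁ t

/-- `W'` is the result of rotating the spin frame `W` by the angle `θ ∈ ℝ` about its second vector. -/
def SpinFrame.Rotate₂ (θ : ℝ) (W W' : SpinFrame) : Prop :=
  ∃ w : ℝ → SpinFrame, Continuous w ∧ w 0 = W ∧ w θ = W' ∧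
    ∀ t, (w t).toFrame = W.toFrame.rotate₂ t

/-- `W'` is the result of translating the spin frame `W` by the signed distance `ρ` along the geodesic
directed by its first vector. -/
def SpinFrame.Translate (ρ : ℝ) (W W' : SpinFrame) : Prop :=
  ∃ w : ℝ → SpinFrame, Continuous w ∧ w 0 = W ∧ w ρ = W' ∧
    ∀ t, (w t).toFrame = W.toFrame.translate t

/-! ## Spin decorations -/

/-- The inward frame `(N^in, v, N^in × v)` of a decorated horosphere at one of its points. -/
def HorD.frameIn (D : HorD) (q : D.H.carrier) : Frame :=
  ⟨q, D.H.Nin q, D.v q, cross q (D.H.Nin q) (D.v q)⟩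

/-- The outward frame `(N^out, v, N^out × v)` of a decorated horosphere at one of its points. -/
def HorD.frameOut (D : HorD) (q : D.H.carrier) : Frame :=
  ⟨q, D.H.Nout q, D.v q, cross q (D.H.Nout q) (D.v q)⟩

/-- A spin-decorated horosphere: a decorated horosphere with continuous lifts of its inward and
outward frame fields to spin frames, associated to each other: `W^in` is `W^out` rotated by `π` about
`v`, and `W^out` is `W^in` rotated by `-π` about `v`. -/
structure HorS extends HorD where
  Win : H.carrier → SpinFrame
  Wout : H.carrier → SpinFrame
  continuous_Win : Continuous Win
  continuous_Wout : Continuous Wout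
  lift_Win : ∀ q, (Win q).toFrame = toHorD.frameIn q
  lift_Wout : ∀ q, (Wout q).toFrame = toHorD.frameOut q
  assoc_in : ∀ q, SpinFrame.Rotate₂ Real.pi (Wout q) (Win q)
  assoc_out : ∀ q, SpinFrame.Rotate₂ (-Real.pi) (Win q) (Wout q)

/-- Continuity of a family of spin-decorated horospheres indexed by the nonzero spinors: the outward
spin frame depends continuously on the spinor `κ` and on the point `q` of the horosphere of `κ`. -/
def IsContinuousFamily (Φ : Spinor → HorS) : Prop :=
  Continuous (fun z : {z : Spinor × Mink // z.2 ∈ (Φ z.1).H.carrier} =>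
    (Φ z.1.1).Wout ⟨z.1.2, z.2⟩)

/-- A correspondence from nonzero spinors to spin-decorated horospheres: a continuous lift of
`Φ₂ ∘ Φ₁`. (There are two; they differ by the deck transformation of the double cover.) -/
def IsSpinCorrespondence (Φ : Spinor → HorS) : Prop :=
  (∀ κ, IsPhi2 (Phi1 κ) (Φ κ).toHorD) ∧ IsContinuousFamily Φ

/-! ## Complex distance and complex lambda length -/

/-- The oriented geodesic from `z` to `w`, distinct points of the celestial sphere, parametrised by
arc length `s`. -/
def geodesic (z w : Mink) (s : ℝ) : Mink :=
  (Real.sqrt (2 * form z w))⁻¹ • (Real.exp (-s) • z + Real.exp s • w)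

/-- The positive unit tangent vector of `geodesic z w` at parameter `s`. -/
def geodesicTangent (z w : Mink) (s : ℝ) : Mink :=
  (Real.sqrt (2 * form z w))⁻¹ • (Real.exp s • w - Real.exp (-s) • z)

/-- A spin frame is adapted to the oriented geodesic from `z` to `w`: it lies over a point of the
geodesic and the first vector of its frame is positively tangent there. -/
def SpinFrame.Adapted (z w : Mink) (W : SpinFrame) : Prop :=
  ∃ s : ℝ, W.toFrame.q = geodesic z w s ∧ W.toFrame.f₁ = geodesicTangent z w s

/-- `d = ρ + iθ` is a complex distance from `W` to `W'`, spin frames adapted to the oriented geodesic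
from `z` to `w`: translation by the signed distance `ρ` along the geodesic followed by rotation by
the angle `θ` about it takes `W` to `W'`. -/
def SpinFrame.IsComplexDistance (z w : Mink) (W W' : SpinFrame) (d : ℂ) : Prop :=
  W.Adapted z w ∧ W'.Adapted z w ∧
    ∃ U : SpinFrame, SpinFrame.Translate d.re W U ∧ SpinFrame.Rotate₁ d.im U W'

/-- `d` is a complex distance from the spin-decorated horosphere `K₁` to `K₂` (with distinct centres):
a complex distance from `W₁^in(q₁)` to `W₂^out(q₂)`, where `q₁, q₂` are the points where the
horospheres meet the oriented geodesic from the centre of `K₁` to the centre of `K₂`. -/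
def HorS.IsComplexDistance (K₁ K₂ : HorS) (d : ℂ) : Prop :=
  ∃ (q₁ : K₁.H.carrier) (q₂ : K₂.H.carrier),
    (q₁ : Mink) ∈ Set.range (geodesic K₁.H.centre K₂.H.centre) ∧
    (q₂ : Mink) ∈ Set.range (geodesic K₁.H.centre K₂.H.centre) ∧
    SpinFrame.IsComplexDistance K₁.H.centre K₂.H.centre (K₁.Win q₁) (K₂.Wout q₂) d

open Classical in
/-- The complex lambda length from `K₁` to `K₂`: `exp(d/2)` for a complex distance `d` from `K₁` to
`K₂`, and `0` if the centres coincide. -/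
def HorS.lambdaLength (K₁ K₂ : HorS) : ℂ :=
  if K₁.H.centre = K₂.H.centre then 0
  else Complex.exp (Classical.epsilon (fun d : ℂ => K₁.IsComplexDistance K₂ d) / 2)

end

end HoroSpin

open HoroSpin

namespace HoroSpin

noncomputable section

/-! A spin frame is a matrix in `SL(2,ℂ)`, and its first column is a spinor. If `A` has first column
`κ`, it carries the null vector `(1,0,0,1)` to `φ₁(κ)` and the base point to a point of the
horosphere of `κ`; there it carries the base frame to the outward frame (`toFrame_eq_frameOut`).
Each point of the horosphere arises from exactly one such `A`. So `W^out` equals `±A`, and by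
connectedness the sign is the same for all spinors and all points (`spinCorrespondence_Wout`).

Moves relative to a frame are right multiplications: `rot π` turns `W^out` into `W^in`, and `lox d =
diag(e^{d/2}, e^{-d/2})` is translation by `Re d` followed by rotation by `Im d`. Hence a complex
distance `d` satisfies `A₂ = A₁ * rot π * lox d`, the common sign having cancelled. Comparing first
columns, `κ₂` is `e^{d/2}` times the second column of `A₁`, and `det A₁ = 1` gives `{κ₁, κ₂} =
e^{d/2}`. Conversely, this equation lets one write down `A₁` and `A₂`, whose base points lie on the
geodesic (`isComplexDistance_iff`). Indeterminacy modulo `4πi` is the periodicity of `exp(d/2)`.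

Existence of a correspondence: the matrix `A` determined by `κ` and `q` depends continuously on
both, and serves as `W^out`. -/

/-! ### Hermitian matrices, the Lorentzian form and the action. -/

theorem toHerm_add (x y : Mink) : toHerm (x + y) = toHerm x + toHerm y := by
  ext i j
  fin_cases i <;> fin_cases j <;> simp [toHerm] <;> ring

theorem toHerm_smul (r : ℝ) (x : Mink) : toHerm (r • x) = (r : ℂ) • toHerm x := by
  ext i j
  fin_cases i <;> fin_cases j <;> simp [toHerm] <;> ring

theorem toHerm_isHermitian (x : Mink) : (toHerm x)ᴴ = toHerm x := by
  ext i j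
  fin_cases i <;> fin_cases j <;> simp [toHerm, Matrix.conjTranspose_apply] <;> ring

theorem ofHerm_toHerm (x : Mink) : ofHerm (toHerm x) = x := by
  ext i
  fin_cases i <;> simp [toHerm, ofHerm] <;> ring

theorem toHerm_injective : Function.Injective toHerm :=
  Function.LeftInverse.injective ofHerm_toHerm

theorem toHerm_ofHerm {S : Matrix (Fin 2) (Fin 2) ℂ} (hS : Sᴴ = S) : toHerm (ofHerm S) = S := by
  have h00 := congrFun (congrFun hS 0) 0
  have h11 := congrFun (congrFun hS 1) 1
  have h10 := congrFun (congrFun hS 1) 0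
  simp only [Matrix.conjTranspose_apply, Complex.ext_iff] at h00 h11 h10
  simp at h00 h11 h10
  ext i j
  fin_cases i <;> fin_cases j <;> apply Complex.ext <;> simp [toHerm, ofHerm] <;> linarith

theorem toHerm_act (A : SL2C) (x : Mink) : toHerm (act A x) = A.1 * toHerm x * A.1ᴴ := by
  refine toHerm_ofHerm ?_
  simp [Matrix.conjTranspose_mul, toHerm_isHermitian, Matrix.mul_assoc]

theorem act_add (A : SL2C) (x y : Mink) : act A (x + y) = act A x + act A y := by
  apply toHerm_injective
  simp [toHerm_act, toHerm_add, Matrix.mul_add, Matrix.add_mul]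

theorem act_smul (A : SL2C) (r : ℝ) (x : Mink) : act A (r • x) = r • act A x := by
  apply toHerm_injective
  simp [toHerm_act, toHerm_smul]

theorem act_sub (A : SL2C) (x y : Mink) : act A (x - y) = act A x - act A y := by
  rw [sub_eq_add_neg, ← neg_one_smul ℝ y, act_add, act_smul, neg_one_smul, ← sub_eq_add_neg]

theorem act_mul (A B : SL2C) (x : Mink) : act (A * B) x = act A (act B x) := by
  apply toHerm_injective
  simp [toHerm_act, Matrix.conjTranspose_mul, Matrix.mul_assoc]

theorem act_one (x : Mink) : act 1 x = x := by
  apply toHerm_injective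
  simp [toHerm_act]

theorem act_neg (A : SL2C) (x : Mink) : act (-A) x = act A x := by
  apply toHerm_injective
  simp [toHerm_act]

theorem form_self (x : Mink) : (form x x : ℂ) = 4 * (toHerm x).det := by
  rw [Matrix.det_fin_two]
  simp [form, toHerm]
  linear_combination (-(x 2 : ℂ) ^ 2) * Complex.I_sq

theorem form_polar (x y : Mink) :
    form x y = (form (x + y) (x + y) - form x x - form y y) / 2 := by
  simp [form]; ring

theorem form_comm (x y : Mink) : form x y = form y x := by
  simp [form]; ring

theorem form_add_left (x y z : Mink) : form (x + y) z = form x z + form y z := by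
  simp [form]; ring

theorem form_smul_left (r : ℝ) (x y : Mink) : form (r • x) y = r * form x y := by
  simp [form]; ring

theorem form_smul_right (r : ℝ) (x y : Mink) : form x (r • y) = r * form x y := by
  simp [form]; ring

theorem form_act (A : SL2C) (x y : Mink) : form (act A x) (act A y) = form x y := by
  have key : ∀ z, form (act A z) (act A z) = form z z := by
    intro z
    have h : (form (act A z) (act A z) : ℂ) = (form z z : ℂ) := by
      rw [form_self, form_self, toHerm_act, Matrix.det_mul, Matrix.det_mul,
        Matrix.det_conjTranspose, A.2]
      simp
    exact_mod_cast h
  rw [form_polar, ← act_add, key, key, key, ← form_polar]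

/-! ### Equivariance of the cross product and of frames. -/

theorem cross_eq (q v w : Mink) : cross q v w =
    ![-(q 1 * (v 3 * w 2 - v 2 * w 3) + q 2 * (v 1 * w 3 - v 3 * w 1)
        + q 3 * (v 2 * w 1 - v 1 * w 2)),
      q 0 * (v 2 * w 3 - v 3 * w 2) + q 2 * (v 3 * w 0 - v 0 * w 3)
        + q 3 * (v 0 * w 2 - v 2 * w 0),
      q 0 * (v 3 * w 1 - v 1 * w 3) + q 1 * (v 0 * w 3 - v 3 * w 0)
        + q 3 * (v 1 * w 0 - v 0 * w 1),
      q 0 * (v 1 * w 2 - v 2 * w 1) + q 1 * (v 2 * w 0 - v 0 * w 2)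
        + q 2 * (v 0 * w 1 - v 1 * w 0)] := by
  ext i
  fin_cases i <;>
    simp [cross, Matrix.det_succ_row_zero, Fin.sum_univ_succ, Fin.succAbove] <;> ring

/-- A formula in matrix products makes equivariance visible: replacing every matrix `S` by `A S A*`,
the inner factors `A* adj(A*)` and `adj(A) A` cancel. -/
theorem toHerm_cross (q v w : Mink) : toHerm (cross q v w) = (2 * Complex.I) •
    (toHerm v * (toHerm q).adjugate * toHerm w - toHerm w * (toHerm q).adjugate * toHerm v) := by
  rw [cross_eq]
  ext i j
  fin_cases i <;> fin_cases j <;> apply Complex.ext <;>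
    simp [toHerm, Matrix.adjugate_fin_two] <;> ring

theorem cross_act (A : SL2C) (q v w : Mink) :
    cross (act A q) (act A v) (act A w) = act A (cross q v w) := by
  apply toHerm_injective
  have h1 : A.1ᴴ * (A.1ᴴ).adjugate = 1 := by
    rw [Matrix.mul_adjugate, Matrix.det_conjTranspose, A.2]; simp
  have h2 : A.1.adjugate * A.1 = 1 := by
    rw [Matrix.adjugate_mul, A.2]; simp
  have key : ∀ V W Q : Matrix (Fin 2) (Fin 2) ℂ,
      A.1 * V * A.1ᴴ * (A.1 * Q * A.1ᴴ).adjugate * (A.1 * W * A.1ᴴ) =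
        A.1 * (V * Q.adjugate * W) * A.1ᴴ := by
    intro V W Q
    rw [Matrix.adjugate_mul_distrib, Matrix.adjugate_mul_distrib]
    calc _ = A.1 * V * (A.1ᴴ * (A.1ᴴ).adjugate) * Q.adjugate * (A.1.adjugate * A.1) * W * A.1ᴴ := by
          simp only [Matrix.mul_assoc]
      _ = _ := by rw [h1, h2]; simp only [Matrix.mul_assoc, Matrix.mul_one]
  rw [toHerm_cross, toHerm_act, toHerm_act, toHerm_act, toHerm_act, toHerm_cross, key, key]
  simp only [Matrix.mul_sub, Matrix.sub_mul, Matrix.mul_smul, Matrix.smul_mul]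

theorem cross_neg_left (q v w : Mink) : cross q (-v) w = -cross q v w := by
  rw [cross_eq, cross_eq]
  ext i
  fin_cases i <;> simp <;> ring

/-- The image of a frame under an element of `SL(2,ℂ)`. -/
def Frame.map (A : SL2C) (F : Frame) : Frame :=
  ⟨act A F.q, act A F.f₁, act A F.f₂, act A F.f₃⟩

theorem Frame.map_mul (A B : SL2C) (F : Frame) : F.map (A * B) = (F.map B).map A := by
  simp [Frame.map, act_mul]

theorem toFrame_eq_map (W : SL2C) : SpinFrame.toFrame W = baseFrame.map W := rfl

theorem Frame.map_one (F : Frame) : F.map 1 = F := by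
  simp [Frame.map, act_one]

theorem Frame.map_rotate₁ (A : SL2C) (F : Frame) (t : ℝ) :
    (F.rotate₁ t).map A = (F.map A).rotate₁ t := by
  simp [Frame.map, Frame.rotate₁, act_add, act_sub, act_smul]

theorem Frame.map_rotate₂ (A : SL2C) (F : Frame) (t : ℝ) :
    (F.rotate₂ t).map A = (F.map A).rotate₂ t := by
  simp [Frame.map, Frame.rotate₂, act_add, act_sub, act_smul]

theorem Frame.map_translate (A : SL2C) (F : Frame) (t : ℝ) :
    (F.translate t).map A = (F.map A).translate t := by
  simp [Frame.map, Frame.translate, act_add, act_smul]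

/-! ### The spin cover: fibres and unique lifting. -/

/-- Fixing the base point makes `C` unitary, so fixing a vector means commuting with its matrix.
Commuting with the matrix of `∂Z` makes `C` diagonal, with that of `-∂X` scalar, and determinant one
leaves `±1`. -/
theorem eq_one_or_neg_one_of_map_baseFrame {C : SL2C} (h : baseFrame.map C = baseFrame) :
    C = 1 ∨ C = -1 := by
  have hq : act C ![1, 0, 0, 0] = ![1, 0, 0, 0] := congrArg Frame.q h
  have h1 : act C ![0, 0, 0, 1] = ![0, 0, 0, 1] := congrArg Frame.f₁ h
  have h3 : act C ![0, -1, 0, 0] = ![0, -1, 0, 0] := congrArg Frame.f₃ h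
  have comm : ∀ x, act C x = x → C.1 * toHerm x * C.1ᴴ = toHerm x := by
    intro x hx
    rw [← toHerm_act, hx]
  have eq := comm _ hq
  have hu : C.1 * C.1ᴴ = 1 := by
    have e : toHerm ![1, 0, 0, 0] = (1 / 2 : ℂ) • (1 : Matrix (Fin 2) (Fin 2) ℂ) := by
      ext i j; fin_cases i <;> fin_cases j <;> simp [toHerm]
    rw [e] at eq
    simp only [Matrix.mul_smul, Matrix.smul_mul, Matrix.mul_one] at eq
    exact smul_right_injective _ (by norm_num : (1 / 2 : ℂ) ≠ 0) eq
  have hu' : C.1ᴴ * C.1 = 1 := mul_eq_one_comm.mp hu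
  have comm' : ∀ x, act C x = x → C.1 * toHerm x = toHerm x * C.1 := by
    intro x hx
    have := congrArg (· * C.1) (comm x hx)
    simpa [Matrix.mul_assoc, hu'] using this
  have c1 := comm' _ h1
  have c3 := comm' _ h3
  have e01 := congrFun (congrFun c1 0) 1
  have e10 := congrFun (congrFun c1 1) 0
  have f01 := congrFun (congrFun c3 0) 1
  simp [toHerm, Matrix.mul_apply, Fin.sum_univ_two] at e01 e10 f01
  have z01 : C.1 0 1 = 0 := by linear_combination -e01
  have z10 : C.1 1 0 = 0 := by linear_combination e10
  have z : C.1 1 1 = C.1 0 0 := by linear_combination -2 * f01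
  have d := C.2
  rw [Matrix.det_fin_two, z01, z10, z] at d
  have : (C.1 0 0 - 1) * (C.1 0 0 + 1) = 0 := by linear_combination d
  rcases mul_eq_zero.mp this with h | h
  · left
    have h' : C.1 0 0 = 1 := by linear_combination h
    ext i j
    fin_cases i <;> fin_cases j <;> simp [z01, z10, z, h']
  · right
    have h' : C.1 0 0 = -1 := by linear_combination h
    ext i j
    fin_cases i <;> fin_cases j <;> simp [z01, z10, z, h']

theorem eq_or_eq_neg_of_toFrame_eq {A B : SL2C}
    (h : SpinFrame.toFrame A = SpinFrame.toFrame B) : A = B ∨ A = -B := by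
  have : baseFrame.map (B⁻¹ * A) = baseFrame := by
    rw [Frame.map_mul, ← toFrame_eq_map, h, toFrame_eq_map, ← Frame.map_mul]
    simp [Frame.map_one]
  rcases eq_one_or_neg_one_of_map_baseFrame this with h | h
  · left
    rw [inv_mul_eq_one] at h; exact h.symm
  · right
    rw [inv_mul_eq_iff_eq_mul] at h
    rw [h]; simp

theorem SL2C.ne_neg_self (A : SL2C) : A ≠ -A := by
  intro h
  have h' : A.1 = 0 := by
    have := congrArg Subtype.val h
    rw [Matrix.SpecialLinearGroup.coe_neg] at this
    ext i j
    have e : A.1 i j = -A.1 i j := congrFun (congrFun this i) j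
    simpa [self_eq_neg] using e
  have d := A.2
  rw [h'] at d
  simp at d

theorem SL2C.continuous_neg : Continuous (fun A : SL2C => -A) := by
  exact continuous_induced_rng.mpr
    ((continuous_subtype_val.neg : Continuous fun A : SL2C => -A.1).congr
      fun A => (Matrix.SpecialLinearGroup.coe_neg A).symm)

/-- On a preconnected space, two continuous maps to `SL(2,ℂ)` which agree up to sign at each point
agree up to a global sign. -/
theorem eq_or_eq_neg_of_forall {X : Type*} [TopologicalSpace X] [PreconnectedSpace X]
    {f g : X → SL2C} (hf : Continuous f) (hg : Continuous g)
    (h : ∀ x, f x = g x ∨ f x = -g x) : (∀ x, f x = g x) ∨ (∀ x, f x = -g x) := by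
  have hc : IsClosed {x | f x = g x} := isClosed_eq hf hg
  have hc' : IsClosed {x | f x = -g x} := isClosed_eq hf (SL2C.continuous_neg.comp hg)
  have hcompl : {x | f x = g x} = {x | f x = -g x}ᶜ := by
    ext x
    simp only [Set.mem_ofPred_eq, Set.mem_compl_iff]
    constructor
    · intro h1 h2
      exact SL2C.ne_neg_self (g x) (h1.symm.trans h2)
    · intro h2
      exact (h x).resolve_right h2
  have hclopen : IsClopen {x | f x = g x} := ⟨hc, by rw [hcompl]; exact hc'.isOpen_compl⟩
  rcases isClopen_iff.mp hclopen with h0 | h1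
  · right
    intro x
    refine (h x).resolve_left fun hx => ?_
    have : x ∈ {x | f x = g x} := hx
    rw [h0] at this
    exact this
  · left
    intro x
    have : x ∈ {x | f x = g x} := h1 ▸ Set.mem_univ x
    exact this

/-- Unique lifting to spin frames of the path of frames given by a path in `SL(2,ℂ)`. -/
theorem exists_lift_iff {R : ℝ → SL2C} (hR : Continuous R) (h0 : R 0 = 1) {F : ℝ → Frame}
    {W W' : SL2C} (hF : ∀ t, SpinFrame.toFrame (W * R t) = F t) (θ : ℝ) :
    (∃ w : ℝ → SpinFrame, Continuous w ∧ w 0 = W ∧ w θ = W' ∧ ∀ t, (w t).toFrame = F t) ↔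
      W' = W * R θ := by
  constructor
  · rintro ⟨w, hw, hw0, hw1, hwF⟩
    rcases eq_or_eq_neg_of_forall hw (g := fun t => W * R t) (continuous_const.mul hR)
      (fun t => eq_or_eq_neg_of_toFrame_eq ((hwF t).trans (hF t).symm)) with h | h
    · rw [← hw1, h]
    -- The other lift of the path starts at `-W`.
    · have := h 0
      simp only [hw0, h0, mul_one] at this
      exact absurd this (SL2C.ne_neg_self W)
  · rintro rfl
    exact ⟨fun t => W * R t, continuous_const.mul hR, by simp [h0], rfl, hF⟩

/-! ### One-parameter subgroups for rotations and translations. -/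

/-- The rotation of `ℝ^{1,3}` by `t` about `∂Y`, as an element of `SL(2,ℂ)`. -/
def rot (t : ℝ) : SL2C :=
  ⟨!![(Real.cos (t / 2) : ℂ), -(Real.sin (t / 2) : ℂ);
      (Real.sin (t / 2) : ℂ), (Real.cos (t / 2) : ℂ)], by
    rw [Matrix.det_fin_two_of]
    norm_cast
    linear_combination Real.sin_sq_add_cos_sq (t / 2)⟩

/-- The loxodromic element `diag(e^{d/2}, e^{-d/2})` of `SL(2,ℂ)`. -/
def lox (d : ℂ) : SL2C :=
  ⟨!![Complex.exp (d / 2), 0; 0, Complex.exp (-(d / 2))], by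
    rw [Matrix.det_fin_two_of, ← Complex.exp_add]; simp⟩

theorem continuous_rot : Continuous rot := by
  refine Continuous.subtype_mk (continuous_matrix fun i j => ?_) _
  fin_cases i <;> fin_cases j <;> simp <;> fun_prop

theorem continuous_lox : Continuous lox := by
  refine Continuous.subtype_mk (continuous_matrix fun i j => ?_) _
  fin_cases i <;> fin_cases j <;> simp <;> fun_prop

theorem rot_zero : rot 0 = 1 := by
  ext i j
  fin_cases i <;> fin_cases j <;> simp [rot]

theorem lox_zero : lox 0 = 1 := by
  ext i j
  fin_cases i <;> fin_cases j <;> simp [lox]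

theorem lox_add (c d : ℂ) : lox (c + d) = lox c * lox d := by
  have h1 : Complex.exp ((c + d) / 2) = Complex.exp (c / 2) * Complex.exp (d / 2) := by
    rw [← Complex.exp_add]; ring_nf
  have h2 : Complex.exp (-((c + d) / 2)) =
      Complex.exp (-(c / 2)) * Complex.exp (-(d / 2)) := by
    rw [← Complex.exp_add]; ring_nf
  apply Subtype.ext
  rw [Matrix.SpecialLinearGroup.coe_mul]
  simp [lox, h1, h2]

theorem rot_map_baseFrame (t : ℝ) : baseFrame.map (rot t) = baseFrame.rotate₂ t := by
  have hc : Real.cos t = Real.cos (t / 2) ^ 2 - Real.sin (t / 2) ^ 2 := by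
    rw [← Real.cos_two_mul']; ring_nf
  have hs : Real.sin t = 2 * Real.sin (t / 2) * Real.cos (t / 2) := by
    rw [← Real.sin_two_mul]; ring_nf
  have h1 := Real.sin_sq_add_cos_sq (t / 2)
  ext i
  all_goals
    fin_cases i <;> simp [Frame.map, baseFrame, Frame.rotate₂, act, rot, ofHerm, toHerm,
      Matrix.mul_apply, Fin.sum_univ_two, Matrix.conjTranspose_apply, -Complex.ofReal_cos,
      -Complex.ofReal_sin, hc, hs]
  all_goals linarith

theorem lox_ofReal_map_baseFrame (t : ℝ) : baseFrame.map (lox t) = baseFrame.translate t := by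
  have e : ∀ s : ℝ, Complex.exp ((s : ℂ) / 2) = ((Real.exp (s / 2) : ℝ) : ℂ) := by
    intro s; push_cast; rfl
  have e' : ∀ s : ℝ, Complex.exp (-((s : ℂ) / 2)) = ((Real.exp (-(s / 2)) : ℝ) : ℂ) := by
    intro s; push_cast; rfl
  have h1 : Real.exp (t / 2) * Real.exp (t / 2) = Real.exp t := by
    rw [← Real.exp_add]; ring_nf
  have h2 : Real.exp (-(t / 2)) * Real.exp (-(t / 2)) = Real.exp (-t) := by
    rw [← Real.exp_add]; ring_nf
  have h3 : Real.exp (t / 2) * Real.exp (-(t / 2)) = 1 := by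
    rw [← Real.exp_add]; simp
  ext i
  all_goals
    fin_cases i <;> simp [Frame.map, baseFrame, Frame.translate, act, lox, ofHerm, toHerm,
      Matrix.mul_apply, Fin.sum_univ_two, Matrix.conjTranspose_apply, e, e', -Complex.ofReal_exp,
      Real.cosh_eq, Real.sinh_eq]
  all_goals linarith

theorem lox_mul_I_map_baseFrame (t : ℝ) :
    baseFrame.map (lox (t * Complex.I)) = baseFrame.rotate₁ t := by
  have e : Complex.exp ((t : ℂ) * Complex.I / 2) =
      (Real.cos (t / 2) : ℂ) + (Real.sin (t / 2) : ℂ) * Complex.I := by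
    push_cast; rw [← Complex.exp_mul_I]; ring_nf
  have e' : Complex.exp (-((t : ℂ) * Complex.I / 2)) =
      (Real.cos (t / 2) : ℂ) - (Real.sin (t / 2) : ℂ) * Complex.I := by
    have : -((t : ℂ) * Complex.I / 2) = ((-(t / 2) : ℝ) : ℂ) * Complex.I := by push_cast; ring
    rw [this, Complex.exp_mul_I, ← Complex.ofReal_cos, ← Complex.ofReal_sin]
    simp [sub_eq_add_neg]
  have hc : Real.cos t = Real.cos (t / 2) ^ 2 - Real.sin (t / 2) ^ 2 := by
    rw [← Real.cos_two_mul']; ring_nf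
  have hs : Real.sin t = 2 * Real.sin (t / 2) * Real.cos (t / 2) := by
    rw [← Real.sin_two_mul]; ring_nf
  have h1 := Real.sin_sq_add_cos_sq (t / 2)
  ext i
  all_goals
    fin_cases i <;> simp [Frame.map, baseFrame, Frame.rotate₁, act, lox, ofHerm, toHerm,
      Matrix.mul_apply, Fin.sum_univ_two, Matrix.conjTranspose_apply, e, e', -Complex.ofReal_cos,
      -Complex.ofReal_sin, hc, hs]
  all_goals linarith

theorem translate_iff {ρ : ℝ} {W W' : SL2C} :
    SpinFrame.Translate ρ W W' ↔ W' = W * lox ρ := by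
  refine exists_lift_iff (R := fun t : ℝ => lox t)
    (continuous_lox.comp Complex.continuous_ofReal) (by simp [lox_zero]) (fun t => ?_) ρ
  rw [toFrame_eq_map, Frame.map_mul, lox_ofReal_map_baseFrame, Frame.map_translate]; rfl

theorem rotate₁_iff {θ : ℝ} {W W' : SL2C} :
    SpinFrame.Rotate₁ θ W W' ↔ W' = W * lox (θ * Complex.I) := by
  refine exists_lift_iff (R := fun t : ℝ => lox (t * Complex.I))
    (continuous_lox.comp (by fun_prop)) (by simp [lox_zero]) (fun t => ?_) θ
  rw [toFrame_eq_map, Frame.map_mul, lox_mul_I_map_baseFrame, Frame.map_rotate₁]; rfl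

theorem rotate₂_iff {θ : ℝ} {W W' : SL2C} :
    SpinFrame.Rotate₂ θ W W' ↔ W' = W * rot θ := by
  refine exists_lift_iff continuous_rot rot_zero (fun t => ?_) θ
  rw [toFrame_eq_map, Frame.map_mul, rot_map_baseFrame, Frame.map_rotate₂]; rfl

/-- Translation along and rotation about the first vector are both one-parameter subgroups of the
diagonal group, so `ρ` and `θ` merge into one complex parameter. -/
theorem exists_translate_rotate₁_iff {d : ℂ} {W W' : SL2C} :
    (∃ U : SpinFrame, SpinFrame.Translate d.re W U ∧ SpinFrame.Rotate₁ d.im U W') ↔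
      W' = W * lox d := by
  simp only [translate_iff, rotate₁_iff, exists_eq_left, mul_assoc, ← lox_add, Complex.re_add_im]

/-! ### Columns of a matrix and the flag of its first column. -/

/-- The columns of a matrix in `SL(2,ℂ)`. -/
def SL2C.col (A : SL2C) (j : Fin 2) : Fin 2 → ℂ := fun i => A.1 i j

theorem SL2C.ext_col {A B : SL2C} (h0 : SL2C.col A 0 = SL2C.col B 0)
    (h1 : SL2C.col A 1 = SL2C.col B 1) : A = B := by
  apply Subtype.ext
  ext i j
  fin_cases j
  · exact congrFun h0 i
  · exact congrFun h1 i

theorem sympl_col (A : SL2C) : sympl (SL2C.col A 0) (SL2C.col A 1) = 1 := by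
  have d := A.2
  rw [Matrix.det_fin_two] at d
  simp only [sympl, SL2C.col]
  linear_combination d

/-- The matrix in `SL(2,ℂ)` with given columns. -/
def SL2C.ofCol (κ μ : Fin 2 → ℂ) (h : sympl κ μ = 1) : SL2C :=
  ⟨!![κ 0, μ 0; κ 1, μ 1], by
    rw [Matrix.det_fin_two_of]
    simp only [sympl] at h
    linear_combination h⟩

theorem SL2C.col_ofCol_zero (κ μ : Fin 2 → ℂ) (h : sympl κ μ = 1) :
    SL2C.col (SL2C.ofCol κ μ h) 0 = κ := by
  ext i; fin_cases i <;> simp [SL2C.col, SL2C.ofCol]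

theorem SL2C.col_ofCol_one (κ μ : Fin 2 → ℂ) (h : sympl κ μ = 1) :
    SL2C.col (SL2C.ofCol κ μ h) 1 = μ := by
  ext i; fin_cases i <;> simp [SL2C.col, SL2C.ofCol]

theorem SL2C.continuous_ofCol {X : Type*} [TopologicalSpace X] {κ μ : X → Fin 2 → ℂ}
    (hκ : Continuous κ) (hμ : Continuous μ) (h : ∀ x, sympl (κ x) (μ x) = 1) :
    Continuous fun x => SL2C.ofCol (κ x) (μ x) (h x) := by
  refine Continuous.subtype_mk (continuous_matrix fun i j => ?_) _
  fin_cases i <;> fin_cases j <;> simp <;> fun_prop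

theorem SL2C.col_zero_ne_zero (A : SL2C) : SL2C.col A 0 ≠ 0 := by
  intro h
  have := sympl_col A
  simp [h, sympl] at this

theorem form_phi1 (κ κ' : Fin 2 → ℂ) :
    form (phi1 κ) (phi1 κ') = 2 * Complex.normSq (sympl κ κ') := by
  rw [phi1_eq, phi1_eq]
  simp [form, sympl, Complex.normSq_apply]
  ring

theorem phi1_smul (c : ℂ) (κ : Fin 2 → ℂ) : phi1 (c • κ) = Complex.normSq c • phi1 κ := by
  rw [phi1_eq, phi1_eq]
  ext i
  fin_cases i <;> simp [Complex.normSq_apply] <;> ring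

theorem phi1_mulVec (A : SL2C) (κ : Fin 2 → ℂ) : phi1 (A.1 *ᵥ κ) = act A (phi1 κ) := by
  have h : (Matrix.vecMulVec κ (star κ))ᴴ = Matrix.vecMulVec κ (star κ) := by
    ext i j
    simp [Matrix.conjTranspose_apply, Matrix.vecMulVec_apply, mul_comm]
  rw [act, phi1, phi1, toHerm_ofHerm h]
  congr 1
  rw [Matrix.mul_vecMulVec, Matrix.vecMulVec_mul, Matrix.star_mulVec]

theorem act_T (A : SL2C) : act A ![1, 0, 0, 0] =
    (1 / 2 : ℝ) • (phi1 (SL2C.col A 0) + phi1 (SL2C.col A 1)) := by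
  rw [phi1_eq, phi1_eq]
  ext i
  fin_cases i <;> simp [act, ofHerm, toHerm, SL2C.col, Matrix.mul_apply, Fin.sum_univ_two,
    Matrix.conjTranspose_apply] <;> ring

theorem act_Z (A : SL2C) : act A ![0, 0, 0, 1] =
    (1 / 2 : ℝ) • (phi1 (SL2C.col A 0) - phi1 (SL2C.col A 1)) := by
  rw [phi1_eq, phi1_eq]
  ext i
  fin_cases i <;> simp [act, ofHerm, toHerm, SL2C.col, Matrix.mul_apply, Fin.sum_univ_two,
    Matrix.conjTranspose_apply] <;> ring

/-- Modulo `ℝ φ₁(κ)` the image of `∂Y` depends only on the first column `κ`, and it lies on the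
positive side of the flag. -/
theorem act_Y (A : SL2C) : ∃ a b : ℝ, 0 < b ∧
    act A ![0, 0, 1, 0] = a • phi1 (SL2C.col A 0) + b • dphi1 (SL2C.col A 0) := by
  have hN := normSq_pos ⟨SL2C.col A 0, SL2C.col_zero_ne_zero A⟩
  have hd := sympl_col A
  simp only [] at hN
  rw [phi1_eq, dphi1_eq]
  have e : act A ![0, 0, 1, 0] =
      ![((A.1 0 0).re * (A.1 0 1).im - (A.1 0 0).im * (A.1 0 1).re)
          + ((A.1 1 0).re * (A.1 1 1).im - (A.1 1 0).im * (A.1 1 1).re),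
        ((A.1 0 0).re * (A.1 1 1).im - (A.1 0 0).im * (A.1 1 1).re)
          + ((A.1 1 0).re * (A.1 0 1).im - (A.1 1 0).im * (A.1 0 1).re),
        ((A.1 0 0).re * (A.1 1 1).re + (A.1 0 0).im * (A.1 1 1).im)
          - ((A.1 1 0).re * (A.1 0 1).re + (A.1 1 0).im * (A.1 0 1).im),
        ((A.1 0 0).re * (A.1 0 1).im - (A.1 0 0).im * (A.1 0 1).re)
          - ((A.1 1 0).re * (A.1 1 1).im - (A.1 1 0).im * (A.1 1 1).re)] := by
    ext i
    fin_cases i <;> simp [act, ofHerm, toHerm, Matrix.mul_apply, Fin.sum_univ_two,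
      Matrix.conjTranspose_apply] <;> ring
  rw [e]
  simp only [SL2C.col, sympl] at hN hd ⊢
  have hr := congrArg Complex.re hd
  have hi := congrArg Complex.im hd
  simp only [Complex.sub_re, Complex.mul_re, Complex.sub_im, Complex.mul_im, Complex.one_re,
    Complex.one_im] at hr hi
  generalize A.1 0 0 = x at *
  generalize A.1 1 0 = y at *
  generalize A.1 0 1 = m at *
  generalize A.1 1 1 = n at *
  obtain ⟨N, hNdef⟩ : ∃ N, N = x.re ^ 2 + x.im ^ 2 + y.re ^ 2 + y.im ^ 2 := ⟨_, rfl⟩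
  rw [← hNdef] at hN
  -- With `N = |κ|²`: `dphi1` has no `T`-component, so `a` is the ratio of the `T`-components; the
  -- image is a unit vector and `dphi1` has norm `2N`, so `b = 1 / (2N)`.
  refine ⟨((x.re * m.im - x.im * m.re) + (y.re * n.im - y.im * n.re)) / N, 1 / (2 * N),
    by positivity, ?_⟩
  ext i
  fin_cases i <;> simp <;> field_simp
  · rw [hNdef]
  · rw [hNdef]
    linear_combination (4 * y.re * y.im - 4 * x.re * x.im) * hr
      + 2 * ((x.re ^ 2 - x.im ^ 2) - (y.re ^ 2 - y.im ^ 2)) * hi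
  · rw [hNdef]
    linear_combination ((x.re ^ 2 - x.im ^ 2) + (y.re ^ 2 - y.im ^ 2)) * hr
      + (2 * y.re * y.im + 2 * x.re * x.im) * hi
  · rw [hNdef]
    linear_combination 4 * (x.re * y.im + x.im * y.re) * hr
      - 4 * (x.re * y.re - x.im * y.im) * hi

theorem act_T_mem_hyp3 (A : SL2C) : act A ![1, 0, 0, 0] ∈ hyp3 := by
  refine ⟨by rw [form_act]; simp [form], ?_⟩
  have hN := normSq_pos ⟨SL2C.col A 0, SL2C.col_zero_ne_zero A⟩
  rw [act_T, phi1_eq, phi1_eq]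
  simp
  simp only [] at hN
  nlinarith [sq_nonneg (SL2C.col A 1 0).re, sq_nonneg (SL2C.col A 1 0).im,
    sq_nonneg (SL2C.col A 1 1).re, sq_nonneg (SL2C.col A 1 1).im]

theorem phi1_col_zero (A : SL2C) :
    phi1 (SL2C.col A 0) = act A ![1, 0, 0, 0] + act A ![0, 0, 0, 1] := by
  rw [act_T, act_Z, ← smul_add]
  simp [smul_smul, ← two_smul ℝ]

theorem form_act_T_phi1 (A : SL2C) : form (act A ![1, 0, 0, 0]) (phi1 (SL2C.col A 0)) = 1 := by
  rw [phi1_col_zero, ← act_add, form_act]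
  simp [form]

/-! ### The matrix determined by a spinor and a point of its horosphere. -/

/-- The second column of the element of `SL(2,ℂ)` with first column `κ` that takes `(1,0,0,0)` to
the point `q` of the horosphere of `κ`. -/
def secondCol (κ : Fin 2 → ℂ) (q : Mink) : Fin 2 → ℂ :=
  ((2 : ℂ) • toHerm q) *ᵥ ![-star (κ 1), star (κ 0)]

/-- The determinant-one condition on the matrix with these columns is exactly the equation of the
horosphere. -/
theorem sympl_secondCol (κ : Fin 2 → ℂ) (q : Mink) :
    sympl κ (secondCol κ q) = (form q (phi1 κ) : ℂ) := by
  rw [phi1_eq]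
  apply Complex.ext <;>
    simp [sympl, secondCol, toHerm, form, Matrix.mulVec, dotProduct, Fin.sum_univ_two,
      -Complex.ofReal_sub, -Complex.ofReal_mul, -Complex.ofReal_add, -Complex.ofReal_pow] <;> ring

theorem continuous_secondCol :
    Continuous fun z : (Fin 2 → ℂ) × Mink => secondCol z.1 z.2 := by
  refine continuous_pi fun i => ?_
  fin_cases i <;>
    simp [secondCol, toHerm, Matrix.mulVec, dotProduct, Fin.sum_univ_two] <;> fun_prop

/-- The element of `SL(2,ℂ)` with first column `κ` that takes `(1,0,0,0)` to the point `q` of the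
horosphere of `κ`. -/
def horoSec (κ : Fin 2 → ℂ) (q : Mink) (h : form q (phi1 κ) = 1) : SL2C :=
  SL2C.ofCol κ (secondCol κ q) (by rw [sympl_secondCol, h, Complex.ofReal_one])

theorem col_horoSec (κ : Fin 2 → ℂ) (q : Mink) (h : form q (phi1 κ) = 1) :
    SL2C.col (horoSec κ q h) 0 = κ := SL2C.col_ofCol_zero _ _ _

theorem act_horoSec {κ : Fin 2 → ℂ} {q : Mink} (hq : q ∈ hyp3) (h : form q (phi1 κ) = 1) :
    act (horoSec κ q h) ![1, 0, 0, 0] = q := by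
  have h1 := h
  have h2 := hq.1
  rw [act_T, col_horoSec, horoSec, SL2C.col_ofCol_one, phi1_eq, phi1_eq]
  rw [phi1_eq] at h1
  simp [form] at h1 h2
  -- The square of the second column is the reflected vector `2⟨q,p⟩q - ⟨q,q⟩p` with `p = φ₁(κ)`;
  -- half its sum with `p` is `q` when both products are `1`.
  ext i
  fin_cases i <;> simp [secondCol, toHerm, Matrix.mulVec, dotProduct, Fin.sum_univ_two]
  · linear_combination q 0 * h1 -
      ((κ 0).re ^ 2 + (κ 0).im ^ 2 + (κ 1).re ^ 2 + (κ 1).im ^ 2) / 2 * h2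
  · linear_combination q 1 * h1 - ((κ 0).re * (κ 1).re + (κ 0).im * (κ 1).im) * h2
  · linear_combination q 2 * h1 - ((κ 0).im * (κ 1).re - (κ 0).re * (κ 1).im) * h2
  · linear_combination q 3 * h1 -
      ((κ 0).re ^ 2 + (κ 0).im ^ 2 - (κ 1).re ^ 2 - (κ 1).im ^ 2) / 2 * h2

/-- If `B` takes the base point to `q`, then `2 toHerm q = B B*`; as `det B = 1`, `B*` sends `(-η̄,
ξ̄)` to `(0, 1)`, which `B` sends to its second column. This gives uniqueness in
`eq_of_col_zero_of_act`. -/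
theorem secondCol_act_T (B : SL2C) :
    secondCol (SL2C.col B 0) (act B ![1, 0, 0, 0]) = SL2C.col B 1 := by
  have e : (2 : ℂ) • toHerm ![1, 0, 0, 0] = (1 : Matrix (Fin 2) (Fin 2) ℂ) := by
    ext i j; fin_cases i <;> fin_cases j <;> simp [toHerm]
  have hM : (2 : ℂ) • toHerm (act B ![1, 0, 0, 0]) = B.1 * B.1ᴴ := by
    rw [toHerm_act, ← Matrix.smul_mul, ← Matrix.mul_smul, e, Matrix.mul_one]
  have d := congrArg star (sympl_col B)
  rw [secondCol, hM, ← Matrix.mulVec_mulVec]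
  simp only [sympl, SL2C.col, star_sub, star_mul', star_one] at d
  have hv : B.1ᴴ *ᵥ ![-star (SL2C.col B 0 1), star (SL2C.col B 0 0)] = ![0, 1] := by
    ext i
    fin_cases i <;>
      simp [Matrix.mulVec, dotProduct, Fin.sum_univ_two, Matrix.conjTranspose_apply, SL2C.col]
    · ring
    · simp at d
      linear_combination d
  rw [hv]
  ext i
  simp [Matrix.mulVec, dotProduct, Fin.sum_univ_two, SL2C.col]

theorem eq_of_col_zero_of_act {A B : SL2C} (h0 : SL2C.col A 0 = SL2C.col B 0)
    (h : act A ![1, 0, 0, 0] = act B ![1, 0, 0, 0]) : A = B := by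
  refine SL2C.ext_col h0 ?_
  rw [← secondCol_act_T, ← secondCol_act_T, h0, h]

/-- An element of `SL(2,ℂ)` with first column `κ` takes the base frame to the outward frame of the
decorated horosphere of `κ`. -/
theorem toFrame_eq_frameOut {κ : Spinor} {D : HorD} (h : IsPhi2 (Phi1 κ) D) {A : SL2C}
    (hA : SL2C.col A 0 = κ.1) (q : D.H.carrier) (hq : act A ![1, 0, 0, 0] = q) :
    SpinFrame.toFrame A = D.frameOut q := by
  have hp : D.H.p = phi1 κ.1 := h.1
  have hp' : D.H.p = act A ![1, 0, 0, 0] + act A ![0, 0, 0, 1] := by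
    rw [hp, ← hA, phi1_col_zero]
  have hN : act A ![0, 0, 0, 1] = D.H.Nout q := by
    rw [Horosphere.Nout, hp', hq]; simp
  have hv : act A ![0, 0, 1, 0] = D.v q := by
    have hmem : act A ![0, 0, 1, 0] ∈
        {x | x ∈ (Phi1 κ).halfPlane ∧ form x q = 0 ∧ form x D.H.p = 0} := by
      refine ⟨?_, ?_, ?_⟩
      · obtain ⟨a, b, hb, e⟩ := act_Y A
        exact ⟨a, b, hb, by rw [e, hA]⟩
      · rw [← hq, form_act]; simp [form]
      · rw [hp', ← act_add, form_act]; simp [form]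
    rw [← h.2 q] at hmem
    obtain ⟨b, hb, e⟩ := hmem
    have hu : form (act A ![0, 0, 1, 0]) (act A ![0, 0, 1, 0]) = -1 := by
      rw [form_act]; simp [form]
    -- Two unit vectors on one open ray coincide: `b ^ 2 = 1` and `b > 0`.
    rw [e, form_smul_left, form_smul_right, D.unit] at hu
    have hb1 : b = 1 := by nlinarith
    rw [e, hb1, one_smul]
  have hc : act A ![0, -1, 0, 0] = cross q (D.H.Nout q) (D.v q) := by
    rw [← hN, ← hv, ← hq, cross_act]
    exact congrArg (act A) baseFrame_isFrame.2.2.2.2.2.2.2.2.2.2.symm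
  simp only [SpinFrame.toFrame, HorD.frameOut, baseFrame, hq, hN, hv, hc]

/-! ### Connectedness and the global sign of a lift. -/

theorem continuous_act (x : Mink) : Continuous fun A : SL2C => act A x := by
  refine continuous_pi fun i => ?_
  have h : ∀ i j, Continuous fun A : SL2C => A.1 i j := fun i j =>
    continuous_subtype_val.matrix_elem i j
  fin_cases i <;> simp [act, ofHerm, Matrix.mul_apply, Fin.sum_univ_two,
    Matrix.conjTranspose_apply, -Complex.add_re, -Complex.add_im, -Complex.mul_re, -Complex.mul_im]
    <;> fun_prop

instance : PreconnectedSpace Spinor := by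
  refine Subtype.preconnectedSpace ?_
  refine (isConnected_compl_singleton_of_one_lt_rank ?_ (0 : Fin 2 → ℂ)).isPreconnected
  rw [← Module.finrank_eq_rank]
  have : Module.finrank ℝ (Fin 2 → ℂ) = 4 := by
    rw [Module.finrank_pi_fintype]; simp
  rw [this]; norm_num

/-- The second column of a matrix in `SL(2,ℂ)` with first column `κ`, in terms of a coordinate `t`. -/
def affineCol (κ : Fin 2 → ℂ) (t : ℂ) : Fin 2 → ℂ :=
  ![-star (κ 1) / (κ 0 * star (κ 0) + κ 1 * star (κ 1)) + t * κ 0,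
    star (κ 0) / (κ 0 * star (κ 0) + κ 1 * star (κ 1)) + t * κ 1]

theorem Spinor.sum_mul_star_ne_zero (κ : Spinor) :
    κ.1 0 * star (κ.1 0) + κ.1 1 * star (κ.1 1) ≠ 0 := by
  intro h
  have h' := congrArg Complex.re h
  have := normSq_pos κ
  simp at h'
  nlinarith

theorem sympl_affineCol (κ : Spinor) (t : ℂ) : sympl κ.1 (affineCol κ.1 t) = 1 := by
  have := Spinor.sum_mul_star_ne_zero κ
  simp only [sympl, affineCol, Matrix.cons_val_zero, Matrix.cons_val_one]
  field_simp
  ring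

/-- A parametrization of `SL(2,ℂ)` by the first column and a coordinate of the second. -/
def slParam (z : Spinor × ℂ) : SL2C :=
  SL2C.ofCol z.1.1 (affineCol z.1.1 z.2) (sympl_affineCol z.1 z.2)

theorem continuous_slParam : Continuous slParam := by
  refine SL2C.continuous_ofCol (by fun_prop) (continuous_pi fun i => ?_) _
  have h := fun z : Spinor × ℂ => Spinor.sum_mul_star_ne_zero z.1
  have h0 : Continuous fun z : Spinor × ℂ => z.1.1 0 :=
    (continuous_apply 0).comp (continuous_subtype_val.comp continuous_fst)
  have h1 : Continuous fun z : Spinor × ℂ => z.1.1 1 :=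
    (continuous_apply 1).comp (continuous_subtype_val.comp continuous_fst)
  have hd := (h0.mul h0.star).add (h1.mul h1.star)
  fin_cases i
  · exact (h1.star.neg.div hd h).add (continuous_snd.mul h0)
  · exact (h0.star.div hd h).add (continuous_snd.mul h1)

theorem exists_slParam (κ : Spinor) (A : SL2C) (h : SL2C.col A 0 = κ.1) :
    ∃ t, slParam (κ, t) = A := by
  have hN := Spinor.sum_mul_star_ne_zero κ
  have d := sympl_col A
  rw [h] at d
  refine ⟨(star (κ.1 0) * SL2C.col A 1 0 + star (κ.1 1) * SL2C.col A 1 1) /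
    (κ.1 0 * star (κ.1 0) + κ.1 1 * star (κ.1 1)), SL2C.ext_col ?_ ?_⟩
  · rw [slParam, SL2C.col_ofCol_zero, h]
  · rw [slParam, SL2C.col_ofCol_one]
    simp only [sympl] at d
    ext i
    fin_cases i <;> simp only [affineCol, Fin.zero_eta, Fin.mk_one, Fin.isValue,
      Matrix.cons_val_zero, Matrix.cons_val_one]
    · rw [← mul_right_inj' hN]
      field_simp
      linear_combination star (κ.1 1) * d
    · rw [← mul_right_inj' hN]
      field_simp
      linear_combination -star (κ.1 0) * d

/-- Both `Wout` and the tautological `A` lift the same outward frame, so they agree up to sign at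
each point. Pulled back by `slParam` to the connected space `Spinor × ℂ`, the sign is constant. -/
theorem spinCorrespondence_Wout {Φ : Spinor → HorS} (h : IsSpinCorrespondence Φ) :
    (∀ κ (q : (Φ κ).H.carrier) (A : SL2C), SL2C.col A 0 = κ.1 → act A ![1, 0, 0, 0] = q →
      (Φ κ).Wout q = A) ∨
    (∀ κ (q : (Φ κ).H.carrier) (A : SL2C), SL2C.col A 0 = κ.1 → act A ![1, 0, 0, 0] = q →
      (Φ κ).Wout q = -A) := by
  have hcol : ∀ z, SL2C.col (slParam z) 0 = z.1.1 := fun z => SL2C.col_ofCol_zero _ _ _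
  have hmem : ∀ z : Spinor × ℂ, act (slParam z) ![1, 0, 0, 0] ∈ (Φ z.1).H.carrier := by
    intro z
    refine ⟨act_T_mem_hyp3 _, ?_⟩
    have : (Φ z.1).H.p = phi1 z.1.1 := (h.1 z.1).1
    rw [this, ← hcol z, form_act_T_phi1]
  have hcont : Continuous fun z : Spinor × ℂ =>
      (⟨(z.1, act (slParam z) ![1, 0, 0, 0]), hmem z⟩ :
        {z : Spinor × Mink // z.2 ∈ (Φ z.1).H.carrier}) :=
    (continuous_fst.prodMk ((continuous_act _).comp continuous_slParam)).subtype_mk _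
  have key := eq_or_eq_neg_of_forall (f := fun z : Spinor × ℂ => (Φ z.1).Wout ⟨_, hmem z⟩)
    (h.2.comp hcont) continuous_slParam (fun z => eq_or_eq_neg_of_toFrame_eq
      (((Φ z.1).lift_Wout _).trans (toFrame_eq_frameOut (h.1 z.1) (hcol z) _ rfl).symm))
  refine key.imp ?_ ?_ <;>
  · intro hk κ q A hA hq
    obtain ⟨t, ht⟩ := exists_slParam κ A hA
    have := hk (κ, t)
    simp only [ht] at this
    rw [← this]
    congr 1
    exact Subtype.ext hq.symm

/-! ### Complex distance in terms of columns. -/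

theorem rot_pi : (rot Real.pi).1 = !![0, -1; 1, 0] := by
  simp [rot]

theorem rot_pi_mul_rot_neg_pi : rot Real.pi * rot (-Real.pi) = 1 := by
  apply Subtype.ext
  rw [Matrix.SpecialLinearGroup.coe_mul]
  ext i j
  fin_cases i <;> fin_cases j <;> simp [rot, neg_div, Matrix.mul_apply]

/-- `rot π` exchanges the columns up to sign and `lox d` rescales them; this is where `e^{d/2}`
enters. -/
theorem col_mul_rot_pi_mul_lox_zero (A : SL2C) (d : ℂ) :
    SL2C.col (A * rot Real.pi * lox d) 0 = Complex.exp (d / 2) • SL2C.col A 1 := by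
  ext i
  simp only [SL2C.col, Matrix.SpecialLinearGroup.coe_mul, rot_pi]
  simp [lox, Matrix.mul_apply, Fin.sum_univ_two, SL2C.col, mul_comm]

theorem col_mul_rot_pi_mul_lox_one (A : SL2C) (d : ℂ) :
    SL2C.col (A * rot Real.pi * lox d) 1 = -(Complex.exp (d / 2))⁻¹ • SL2C.col A 0 := by
  ext i
  simp only [SL2C.col, Matrix.SpecialLinearGroup.coe_mul, rot_pi]
  simp [lox, Matrix.mul_apply, Fin.sum_univ_two, SL2C.col, mul_comm, Complex.exp_neg]

theorem sympl_smul_right (c : ℂ) (κ κ' : Fin 2 → ℂ) : sympl κ (c • κ') = c * sympl κ κ' := by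
  simp [sympl]; ring

theorem sympl_swap (κ κ' : Fin 2 → ℂ) : sympl κ κ' = -sympl κ' κ := by
  simp [sympl]; ring

theorem form_smul_smul (a b : ℝ) (x y : Mink) : form (a • x) (b • y) = a * b * form x y := by
  rw [form_smul_left, form_smul_right]; ring

/-- The hypothesis on `a` and `b` normalises `a • p₁ + b • p₂` to be a unit vector; positive
combinations of this kind are the points of the geodesic. The parameter `s` comes from comparing
coefficients of `p₂`. -/
theorem exists_geodesic_eq {p₁ p₂ : Mink} {a b : ℝ} (h1 : 0 < p₁ 0) (h2 : 0 < p₂ 0)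
    (ha : 0 < a) (hb : 0 < b) (h : 2 * a * b * form p₁ p₂ = 1) :
    ∃ s, a • p₁ + b • p₂ = geodesic ((p₁ 0)⁻¹ • p₁) ((p₂ 0)⁻¹ • p₂) s ∧
      b • p₂ - a • p₁ = geodesicTangent ((p₁ 0)⁻¹ • p₁) ((p₂ 0)⁻¹ • p₂) s := by
  have hab : 0 < 2 * a * b := by positivity
  have hf : 0 < form p₁ p₂ := by
    by_contra hn
    nlinarith [mul_nonneg hab.le (neg_nonneg.mpr (not_lt.mp hn))]
  obtain ⟨c, hc⟩ : ∃ c, c = (Real.sqrt (2 * form ((p₁ 0)⁻¹ • p₁) ((p₂ 0)⁻¹ • p₂)))⁻¹ := ⟨_, rfl⟩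
  have hpos : 0 < 2 * form ((p₁ 0)⁻¹ • p₁) ((p₂ 0)⁻¹ • p₂) := by
    rw [form_smul_smul]; positivity
  have hc0 : 0 < c := by rw [hc]; positivity
  have hc2 : c ^ 2 * (2 * form p₁ p₂) = p₁ 0 * p₂ 0 := by
    rw [hc, inv_pow, Real.sq_sqrt hpos.le, form_smul_smul]
    field_simp
  have hs : Real.exp (Real.log (b * p₂ 0 / c)) = b * p₂ 0 / c := Real.exp_log (by positivity)
  have e1 : c * Real.exp (-Real.log (b * p₂ 0 / c)) * (p₁ 0)⁻¹ = a := by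
    rw [Real.exp_neg, hs]
    field_simp
    have : c ^ 2 * (2 * form p₁ p₂) = (2 * a * b * form p₁ p₂) * (p₁ 0 * p₂ 0) := by
      rw [h, hc2, one_mul]
    have h' : (2 * form p₁ p₂) * (c ^ 2) = (2 * form p₁ p₂) * (b * p₂ 0 * p₁ 0 * a) := by
      linear_combination this
    exact mul_left_cancel₀ (by positivity) h'
  have e2 : c * Real.exp (Real.log (b * p₂ 0 / c)) * (p₂ 0)⁻¹ = b := by
    rw [hs]; field_simp
  refine ⟨Real.log (b * p₂ 0 / c), ?_, ?_⟩
  · rw [geodesic, ← hc, smul_add, smul_smul, smul_smul, smul_smul, smul_smul, e1, e2]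
  · rw [geodesicTangent, ← hc, smul_sub, smul_smul, smul_smul, smul_smul, smul_smul, e1, e2]

/-- The product of `φ₁(κ₁)` and `φ₁(κ₂)` is `2|{κ₁,κ₂}|²`, which vanishes when the null rays
coincide; conversely `{κ₁,κ₂} = 0` makes the spinors proportional, and `φ₁` scales by a positive
factor. -/
theorem centre_eq_iff {K₁ K₂ : Horosphere} {κ₁ κ₂ : Spinor} (h1 : K₁.p = phi1 κ₁.1)
    (h2 : K₂.p = phi1 κ₂.1) : K₁.centre = K₂.centre ↔ sympl κ₁.1 κ₂.1 = 0 := by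
  have t1 : 0 < phi1 κ₁.1 0 := (phi1_mem κ₁).2
  have t2 : 0 < phi1 κ₂.1 0 := (phi1_mem κ₂).2
  constructor
  · intro h
    rw [Horosphere.centre, Horosphere.centre, h1, h2] at h
    have hf := congrArg (fun x => form x ((phi1 κ₂.1 0)⁻¹ • phi1 κ₂.1)) h
    simp only [form_smul_smul] at hf
    rw [(phi1_mem κ₂).1, mul_zero, form_phi1] at hf
    have h0 : Complex.normSq (sympl κ₁.1 κ₂.1) = 0 := by
      by_contra hne
      have : (phi1 κ₁.1 0)⁻¹ * (phi1 κ₂.1 0)⁻¹ * (2 * Complex.normSq (sympl κ₁.1 κ₂.1)) ≠ 0 := by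
        have := t1.ne'
        have := t2.ne'
        positivity
      exact this hf
    exact Complex.normSq_eq_zero.mp h0
  · intro h
    obtain ⟨c, hc⟩ : ∃ c : ℂ, κ₂.1 = c • κ₁.1 := by
      simp only [sympl] at h
      by_cases h0 : κ₁.1 0 = 0
      · have h1' : κ₁.1 1 ≠ 0 := by
          intro h1'
          apply κ₁.2
          ext i; fin_cases i <;> simp [h0, h1']
        refine ⟨κ₂.1 1 / κ₁.1 1, ?_⟩
        ext i
        fin_cases i <;> simp <;> field_simp
        linear_combination -h
      · refine ⟨κ₂.1 0 / κ₁.1 0, ?_⟩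
        ext i
        fin_cases i <;> simp <;> field_simp
        linear_combination h
    have hc0 : c ≠ 0 := by
      rintro rfl
      exact κ₂.2 (by rw [hc, zero_smul])
    have hn : Complex.normSq c ≠ 0 := by simpa using hc0
    have := t1.ne'
    rw [Horosphere.centre, Horosphere.centre, h1, h2, hc, phi1_smul, smul_smul]
    congr 1
    simp only [Pi.smul_apply, smul_eq_mul]
    field_simp

/-- Writing the sign as a left factor `s` lets it cancel between the two horospheres, so either lift
gives the same distances. -/
theorem exists_spinCorrespondence_Wout {Φ : Spinor → HorS} (h : IsSpinCorrespondence Φ) :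
    ∃ s : SL2C, ∀ κ (q : (Φ κ).H.carrier) (A : SL2C), SL2C.col A 0 = κ.1 →
      act A ![1, 0, 0, 0] = q → (Φ κ).Wout q = s * A := by
  rcases spinCorrespondence_Wout h with h | h
  · exact ⟨1, fun κ q A hA hq => by rw [h κ q A hA hq, one_mul]⟩
  · exact ⟨-1, fun κ q A hA hq => by rw [h κ q A hA hq, neg_one_mul]⟩

theorem isComplexDistance_iff {Φ : Spinor → HorS} (h : IsSpinCorrespondence Φ) (κ₁ κ₂ : Spinor)
    (d : ℂ) : (Φ κ₁).IsComplexDistance (Φ κ₂) d ↔ sympl κ₁.1 κ₂.1 = Complex.exp (d / 2) := by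
  obtain ⟨s, hs⟩ := exists_spinCorrespondence_Wout h
  have hp : ∀ κ, (Φ κ).H.p = phi1 κ.1 := fun κ => (h.1 κ).1
  have hWin : ∀ κ q, (Φ κ).Win q = (Φ κ).Wout q * rot Real.pi := fun κ q =>
    rotate₂_iff.mp ((Φ κ).assoc_in q)
  constructor
  · rintro ⟨q₁, q₂, -, -, -, -, hU⟩
    rw [exists_translate_rotate₁_iff, hWin] at hU
    have hq : ∀ κ (q : (Φ κ).H.carrier), ∃ A : SL2C, SL2C.col A 0 = κ.1 ∧
        act A ![1, 0, 0, 0] = q := fun κ q =>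
      have hf : form (q : Mink) (phi1 κ.1) = 1 := by rw [← hp]; exact q.2.2
      ⟨horoSec κ.1 q hf, col_horoSec _ _ _, act_horoSec q.2.1 hf⟩
    obtain ⟨A₁, h1, hq1⟩ := hq κ₁ q₁
    obtain ⟨A₂, h2, hq2⟩ := hq κ₂ q₂
    rw [hs _ _ _ h1 hq1, hs _ _ _ h2 hq2, mul_assoc, mul_assoc, mul_right_inj, ← mul_assoc] at hU
    rw [← h1, ← h2, hU, col_mul_rot_pi_mul_lox_zero, sympl_smul_right, sympl_col, mul_one]
  · intro hd
    have hne : Complex.exp (d / 2) ≠ 0 := Complex.exp_ne_zero _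
    -- The column identities force `A₁ = (κ₁, e^{-d/2} κ₂)` and `A₂ = (κ₂, -e^{-d/2} κ₁)`; their
    -- determinants are one by the hypothesis on `d`.
    have s1 : sympl κ₁.1 ((Complex.exp (d / 2))⁻¹ • κ₂.1) = 1 := by
      rw [sympl_smul_right, hd, inv_mul_cancel₀ hne]
    have s2 : sympl κ₂.1 (-(Complex.exp (d / 2))⁻¹ • κ₁.1) = 1 := by
      rw [sympl_smul_right, sympl_swap, hd, neg_mul_neg, inv_mul_cancel₀ hne]
    obtain ⟨A₁, h10, h11⟩ : ∃ A : SL2C, SL2C.col A 0 = κ₁.1 ∧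
        SL2C.col A 1 = (Complex.exp (d / 2))⁻¹ • κ₂.1 :=
      ⟨SL2C.ofCol _ _ s1, SL2C.col_ofCol_zero _ _ _, SL2C.col_ofCol_one _ _ _⟩
    obtain ⟨A₂, h20, h21⟩ : ∃ A : SL2C, SL2C.col A 0 = κ₂.1 ∧
        SL2C.col A 1 = -(Complex.exp (d / 2))⁻¹ • κ₁.1 :=
      ⟨SL2C.ofCol _ _ s2, SL2C.col_ofCol_zero _ _ _, SL2C.col_ofCol_one _ _ _⟩
    have hA : A₂ = A₁ * rot Real.pi * lox d := by
      refine SL2C.ext_col ?_ ?_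
      · rw [col_mul_rot_pi_mul_lox_zero, h11, h20, smul_smul, mul_inv_cancel₀ hne, one_smul]
      · rw [col_mul_rot_pi_mul_lox_one, h10, h21]
    have m1 : act A₁ ![1, 0, 0, 0] ∈ (Φ κ₁).H.carrier :=
      ⟨act_T_mem_hyp3 _, by rw [hp, ← h10, form_act_T_phi1]⟩
    have m2 : act A₂ ![1, 0, 0, 0] ∈ (Φ κ₂).H.carrier :=
      ⟨act_T_mem_hyp3 _, by rw [hp, ← h20, form_act_T_phi1]⟩
    obtain ⟨n, hn⟩ : ∃ n, n = Complex.normSq (Complex.exp (d / 2)) := ⟨_, rfl⟩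
    have hn0 : 0 < n := by rw [hn]; exact Complex.normSq_pos.mpr hne
    -- The base points are positive combinations of the two null vectors, hence on the geodesic.
    have e1 : act A₁ ![1, 0, 0, 0] = (1 / 2 : ℝ) • phi1 κ₁.1 + (n⁻¹ / 2) • phi1 κ₂.1 := by
      rw [act_T, h10, h11, phi1_smul, Complex.normSq_inv, ← hn, smul_add, smul_smul]
      ring_nf
    have e2 : act A₂ ![1, 0, 0, 0] = (n⁻¹ / 2) • phi1 κ₁.1 + (1 / 2 : ℝ) • phi1 κ₂.1 := by
      rw [act_T, h20, h21, phi1_smul, Complex.normSq_neg, Complex.normSq_inv, ← hn, smul_add,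
        smul_smul, add_comm]
      ring_nf
    have hf : form (phi1 κ₁.1) (phi1 κ₂.1) = 2 * n := by rw [form_phi1, hd, hn]
    have t1 : 0 < phi1 κ₁.1 0 := (phi1_mem κ₁).2
    have t2 : 0 < phi1 κ₂.1 0 := (phi1_mem κ₂).2
    have c1 : (Φ κ₁).H.centre = (phi1 κ₁.1 0)⁻¹ • phi1 κ₁.1 := by rw [Horosphere.centre, hp]
    have c2 : (Φ κ₂).H.centre = (phi1 κ₂.1 0)⁻¹ • phi1 κ₂.1 := by rw [Horosphere.centre, hp]
    obtain ⟨r₁, g1, g1'⟩ := exists_geodesic_eq (a := 1 / 2) (b := n⁻¹ / 2) t1 t2 (by positivity)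
      (by positivity) (by rw [hf]; field_simp)
    obtain ⟨r₂, g2, g2'⟩ := exists_geodesic_eq (a := n⁻¹ / 2) (b := 1 / 2) t1 t2 (by positivity)
      (by positivity) (by rw [hf]; field_simp)
    refine ⟨⟨_, m1⟩, ⟨_, m2⟩, ⟨r₁, ?_⟩, ⟨r₂, ?_⟩, ⟨r₁, ?_, ?_⟩, ⟨r₂, ?_, ?_⟩, ?_⟩
    · rw [c1, c2, ← g1]; exact e1.symm
    · rw [c1, c2, ← g2]; exact e2.symm
    · rw [(Φ κ₁).lift_Win, c1, c2, ← g1]; exact e1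
    · rw [(Φ κ₁).lift_Win, c1, c2, ← g1']
      simp only [HorD.frameIn, Horosphere.Nin, hp, e1]
      module
    · rw [(Φ κ₂).lift_Wout, c1, c2, ← g2]; exact e2
    · rw [(Φ κ₂).lift_Wout, c1, c2, ← g2']
      simp only [HorD.frameOut, Horosphere.Nout, hp, e2]
      module
    · rw [exists_translate_rotate₁_iff, hWin, hs _ _ _ h10 rfl, hs _ _ _ h20 rfl, hA]
      simp only [mul_assoc]

/-! ### Construction of a spin correspondence -/

/-- Fixing `φ₁(κ)` makes `κ` an eigenvector, and a parabolic element of `SL(2,ℂ)` has the double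
eigenvalue `1` or `-1`. This yields parallelism of the decoration. -/
theorem act_col_of_parabolic {A B : SL2C} (hA : A.1.IsParabolic)
    (hp : act A (phi1 (SL2C.col B 0)) = phi1 (SL2C.col B 0)) :
    SL2C.col (A * B) 0 = SL2C.col B 0 ∨ SL2C.col (A * B) 0 = -SL2C.col B 0 := by
  have hcol : SL2C.col (A * B) 0 = A.1 *ᵥ SL2C.col B 0 := by
    ext i
    simp [SL2C.col, Matrix.mul_apply, Matrix.mulVec, dotProduct]
  rw [hcol]
  generalize hκ : SL2C.col B 0 = κ at *
  have hκ0 : κ ≠ 0 := hκ ▸ SL2C.col_zero_ne_zero B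
  have hs : sympl (A.1 *ᵥ κ) κ = 0 := by
    have hf : form (phi1 (A.1 *ᵥ κ)) (phi1 κ) = 0 := by
      rw [phi1_mulVec, hp]; exact (phi1_mem ⟨κ, hκ0⟩).1
    rw [form_phi1] at hf
    exact Complex.normSq_eq_zero.mp (by linarith)
  have hd := A.2
  have hdisc := hA.2
  rw [Matrix.discr_fin_two, Matrix.trace_fin_two, hd] at hdisc
  rw [Matrix.det_fin_two] at hd
  have ht : (A.1 0 0 + A.1 1 1 - 2) * (A.1 0 0 + A.1 1 1 + 2) = 0 := by
    linear_combination hdisc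
  have e : A.1 *ᵥ κ = ![A.1 0 0 * κ 0 + A.1 0 1 * κ 1, A.1 1 0 * κ 0 + A.1 1 1 * κ 1] := by
    ext i; fin_cases i <;> simp [Matrix.mulVec, dotProduct, Fin.sum_univ_two]
  rw [e] at hs ⊢
  simp only [sympl, Matrix.cons_val_zero, Matrix.cons_val_one] at hs
  generalize A.1 0 0 = a at *
  generalize A.1 0 1 = b at *
  generalize A.1 1 0 = c at *
  generalize A.1 1 1 = d at *
  have key : ∀ ε : ℂ, ε ^ 2 = 1 → a + d = 2 * ε →
      ![a * κ 0 + b * κ 1, c * κ 0 + d * κ 1] = ε • κ := by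
    intro ε hε htr
    have hd' : d = 2 * ε - a := by linear_combination htr
    subst hd'
    -- `A - ε` is nilpotent and `κ` is an eigenvector of it, so it kills `κ`; coordinatewise, the
    -- squares vanish.
    have nil : (a - ε) ^ 2 + b * c = 0 := by linear_combination hε - hd
    have hu : (a * κ 0 + b * κ 1 - ε * κ 0) ^ 2 = 0 := by
      linear_combination κ 0 ^ 2 * nil + b * hs
    have hw : (c * κ 0 + (2 * ε - a) * κ 1 - ε * κ 1) ^ 2 = 0 := by
      linear_combination κ 1 ^ 2 * nil - c * hs
    have hu' := pow_eq_zero_iff two_ne_zero |>.mp hu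
    have hw' := pow_eq_zero_iff two_ne_zero |>.mp hw
    ext i
    fin_cases i <;> simp
    · linear_combination hu'
    · linear_combination hw'
  rcases mul_eq_zero.mp ht with h | h
  · left
    rw [key 1 (by norm_num) (by linear_combination h), one_smul]
  · right
    rw [key (-1) (by norm_num) (by linear_combination h), neg_one_smul]

theorem form_phi1_eq_one {κ : Spinor}
    (q : (⟨phi1 κ.1, phi1_mem κ⟩ : Horosphere).carrier) : form (q : Mink) (phi1 κ.1) = 1 := q.2.2

/-- The decorated horosphere of a nonzero spinor. -/
def spinorHorD (κ : Spinor) : HorD where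
  H := ⟨phi1 κ.1, phi1_mem κ⟩
  v q := act (horoSec κ.1 q (form_phi1_eq_one q)) ![0, 0, 1, 0]
  tangent q := by
    have hA := act_horoSec q.2.1 (form_phi1_eq_one q)
    have hc := col_horoSec κ.1 q (form_phi1_eq_one q)
    generalize horoSec κ.1 q (form_phi1_eq_one q) = A at *
    constructor
    · rw [← hA, form_act]; simp [form]
    · change form (act A ![0, 0, 1, 0]) (phi1 κ.1) = 0
      rw [← hc, phi1_col_zero, ← act_add, form_act]; simp [form]
  unit q := by
    rw [form_act]; simp [form]
  parallel A hA hp q q' hq := by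
    have hB := act_horoSec q.2.1 (form_phi1_eq_one q)
    have hc := col_horoSec κ.1 q (form_phi1_eq_one q)
    have hB' := act_horoSec q'.2.1 (form_phi1_eq_one q')
    have hc' := col_horoSec κ.1 q' (form_phi1_eq_one q')
    generalize horoSec κ.1 q (form_phi1_eq_one q) = B at *
    generalize horoSec κ.1 q' (form_phi1_eq_one q') = B' at *
    have hAB : act (A * B) ![1, 0, 0, 0] = q' := by rw [act_mul, hB, hq]
    rw [← act_mul]
    simp only at hp
    rw [← hc] at hp
    rcases act_col_of_parabolic hA hp with h | h
    · rw [eq_of_col_zero_of_act (A := B') (B := A * B) (by rw [h, hc, hc']) (by rw [hAB, hB'])]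
    -- The sign is invisible on vectors, since `-1` acts trivially.
    · rw [← act_neg (A * B)]
      rw [eq_of_col_zero_of_act (A := B') (B := -(A * B)) _ (by rw [act_neg, hAB, hB'])]
      rw [hc', ← hc, ← neg_neg (SL2C.col B 0), ← h]
      ext i
      simp [SL2C.col]

/-- Since `⟨φ₁(κ), q⟩ = 1`, orthogonality to `q` determines the coefficient of `φ₁(κ)` from that of
`dphi1`, so the half-plane meets the tangent space in a single ray. -/
theorem isPhi2_spinorHorD (κ : Spinor) : IsPhi2 (Phi1 κ) (spinorHorD κ) := by
  refine ⟨rfl, fun q => ?_⟩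
  have hA := act_horoSec q.2.1 (form_phi1_eq_one q)
  have hc := col_horoSec κ.1 q (form_phi1_eq_one q)
  have htan := (spinorHorD κ).tangent q
  obtain ⟨a, b, hb, e⟩ := act_Y (horoSec κ.1 q (form_phi1_eq_one q))
  rw [hc] at e
  have e' : (spinorHorD κ).v q = a • phi1 κ.1 + b • dphi1 κ.1 := e
  have hpq : form (phi1 κ.1) q = 1 := by rw [form_comm]; exact form_phi1_eq_one q
  ext x
  constructor
  · rintro ⟨t, ht, rfl⟩
    refine ⟨⟨t * a, t * b, mul_pos ht hb, ?_⟩, ?_, ?_⟩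
    · rw [e', smul_add, smul_smul, smul_smul]
    · rw [form_smul_left, htan.1, mul_zero]
    · rw [form_smul_left, htan.2, mul_zero]
  · rintro ⟨⟨a', b', hb', rfl⟩, hq, -⟩
    refine ⟨b' / b, div_pos hb' hb, ?_⟩
    have h1 := htan.1
    rw [e', form_add_left, form_smul_left, form_smul_left, hpq] at h1
    have hq' : form (a' • phi1 κ.1 + b' • dphi1 κ.1) q = 0 := hq
    rw [form_add_left, form_smul_left, form_smul_left, hpq] at hq'
    have ha : b' / b * a = a' := by
      field_simp
      linear_combination b' * h1 - b * hq'
    rw [e', smul_add, smul_smul, smul_smul, ha, div_mul_cancel₀ _ hb.ne']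

/-- The spin-decorated horosphere of a nonzero spinor. -/
def spinorHorS (κ : Spinor) : HorS where
  toHorD := spinorHorD κ
  Wout q := horoSec κ.1 q (form_phi1_eq_one q)
  Win q := horoSec κ.1 q (form_phi1_eq_one q) * rot Real.pi
  continuous_Wout := SL2C.continuous_ofCol continuous_const
    (continuous_secondCol.comp (continuous_const.prodMk continuous_subtype_val)) _
  continuous_Win := (SL2C.continuous_ofCol continuous_const
    (continuous_secondCol.comp (continuous_const.prodMk continuous_subtype_val)) _).mul
      continuous_const
  lift_Wout q := toFrame_eq_frameOut (isPhi2_spinorHorD κ) (col_horoSec _ _ _) q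
    (act_horoSec q.2.1 (form_phi1_eq_one q))
  lift_Win q := by
    have h := toFrame_eq_frameOut (isPhi2_spinorHorD κ)
      (col_horoSec κ.1 q (form_phi1_eq_one q)) q (act_horoSec q.2.1 (form_phi1_eq_one q))
    rw [toFrame_eq_map, Frame.map_mul, rot_map_baseFrame, Frame.map_rotate₂, ← toFrame_eq_map, h]
    have hN : (spinorHorD κ).H.Nin q = -(spinorHorD κ).H.Nout q := by
      simp [Horosphere.Nin, Horosphere.Nout]
    simp [Frame.rotate₂, HorD.frameOut, HorD.frameIn, hN, cross_neg_left]
  assoc_in q := rotate₂_iff.mpr rfl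
  assoc_out q := rotate₂_iff.mpr (by rw [mul_assoc, rot_pi_mul_rot_neg_pi, mul_one])

theorem isSpinCorrespondence_spinorHorS : IsSpinCorrespondence spinorHorS := by
  refine ⟨isPhi2_spinorHorD, ?_⟩
  have h1 : Continuous fun z : {z : Spinor × Mink // z.2 ∈ (spinorHorS z.1).H.carrier} =>
      z.1.1.1 := continuous_subtype_val.comp (continuous_fst.comp continuous_subtype_val)
  have h2 : Continuous fun z : {z : Spinor × Mink // z.2 ∈ (spinorHorS z.1).H.carrier} =>
      z.1.2 := continuous_snd.comp continuous_subtype_val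
  exact SL2C.continuous_ofCol h1 (continuous_secondCol.comp (h1.prodMk h2)) fun z => by
    rw [Function.comp_apply, sympl_secondCol, form_phi1_eq_one ⟨z.1.2, z.2⟩, Complex.ofReal_one]

end
end HoroSpin

theorem theorem2 :
    (∃ Φ : HoroSpin.Spinor → HoroSpin.HorS, HoroSpin.IsSpinCorrespondence Φ) ∧
    ∀ Φ : HoroSpin.Spinor → HoroSpin.HorS, HoroSpin.IsSpinCorrespondence Φ →
      ∀ κ₁ κ₂ : HoroSpin.Spinor,
        ((Φ κ₁).H.centre ≠ (Φ κ₂).H.centre →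
          (∃ d : ℂ, (Φ κ₁).IsComplexDistance (Φ κ₂) d) ∧
          ∀ d : ℂ, (Φ κ₁).IsComplexDistance (Φ κ₂) d ↔
            HoroSpin.sympl κ₁.1 κ₂.1 = Complex.exp (d / 2)) ∧
        HoroSpin.sympl κ₁.1 κ₂.1 = (Φ κ₁).lambdaLength (Φ κ₂) := by
  refine ⟨⟨_, isSpinCorrespondence_spinorHorS⟩, fun Φ hΦ κ₁ κ₂ => ?_⟩
  have hc : (Φ κ₁).H.centre = (Φ κ₂).H.centre ↔ sympl κ₁.1 κ₂.1 = 0 :=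
    centre_eq_iff (hΦ.1 κ₁).1 (hΦ.1 κ₂).1
  have hex : (Φ κ₁).H.centre ≠ (Φ κ₂).H.centre →
      ∃ d : ℂ, (Φ κ₁).IsComplexDistance (Φ κ₂) d := by
    intro hne
    refine ⟨2 * Complex.log (sympl κ₁.1 κ₂.1), (isComplexDistance_iff hΦ _ _ _).mpr ?_⟩
    rw [mul_div_cancel_left₀ _ two_ne_zero, Complex.exp_log (fun h => hne (hc.mpr h))]
  refine ⟨fun hne => ⟨hex hne, isComplexDistance_iff hΦ κ₁ κ₂⟩, ?_⟩
  by_cases h : (Φ κ₁).H.centre = (Φ κ₂).H.centre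
  · rw [HorS.lambdaLength, if_pos h, hc.mp h]
  · rw [HorS.lambdaLength, if_neg h]
    -- Whichever distance `epsilon` picks, its `exp(d/2)` is `{κ₁, κ₂}`.
    exact (isComplexDistance_iff hΦ κ₁ κ₂ _).mp (Classical.epsilon_spec (hex h))
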